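/- **Setting.** Let $N,M_1,M_2,M_3\ge 1$ and $k$ be integers, $k\ge 0$, $\varepsilon=1/N$, $x_\ell=\varepsilon\ell$ for $\ell\in\mathbb Z^3$, $\Omega=\prod_{i=1}^3[-M_i+1,M_i]$ and $\mathfrak L=\mathbb Z^3\cap\frac1\varepsilon\Omega$. Let $R\subset\mathbb Z^3$ be finite with $\eta_1\eta_2\eta_3\neq0$ for all $\eta\in R$, and let $\phi_\eta:\mathbb R^3\to\mathbb R$ ($\eta\in R$) be $C^1$. Write $y_\ell=y(x_\ell)$ and $\overline D_\eta y_\ell=(y_{\ell+\eta}-y_\ell)/\varepsilon$. For $\ell,\eta\in\mathbb{Z}^3$ with $\eta_1\eta_2\eta_3\ne0$, the bond volume $B_{\ell,\eta}$ is the open box with edges parallel to the axes and main diagonal from $x_\ell$ to $x_{\ell+\eta}$. Its type A decomposition consists of the six tetrahedra whose edges are the edges of the box, this main diagonal, and the face diagonals starting at $x_\ell$ or at $x_{\ell+\eta}$. A lattice tetrahedron is a tetrahedron of the type A decomposition of a lattice cell $B_{\ell,(1,1,1)}$. A set of (closed) tetrahedra with lattice vertices is conforming if any two of them meet exactly in the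 (possibly empty) face spanned by their common vertices; two such sets are compatible if the same holds for any member of the first and any member of the second. **Regions.** $\Omega_a$ (atomistic) and $\Omega_*$ (continuum) are disjoint connected sets, each the interior of the closure of a union of lattice tetrahedra contained in $\Omega$, with $\Omega=\overline\Omega_a\cup\overline\Omega_*$; the interface is $\Gamma=\overline\Omega_a\cap\overline\Omega_*$. The set $\overline\Omega_a$ lies in the interior of $\Omega$, far enough from $\partial\Omega$ that every $\overline B_{\ell,\eta}$, $\eta\in R$, $\ell\in\mathbb Z^3$, meeting $\overline\Omega_a$ lies in the interior of $\Omega$. For $\eta\in R$, a bond volume is of class (a) if $\overline B_{\ell,\eta}\subset\Omega_a$, of class (b) if $B_{\ell,\eta}\subset\Omega_*$ or (periodic extension) $B_{\ell,\eta}\not\subset\Omega$, and belongs to $B_\Gamma$ otherwise. **Interface decompositions.** For each $\eta\in R$, each $B_{\ell,\eta}\in B_\Gamma$ has a conforming decomposition $\mathcal T(B_{\ell,\eta})$ into tetrahedra with vertices in $\varepsilon\mathbb Z^3$, each contained in $\overline\Omega_a$ or in $\overline\Omega_*$, those in $\overline\Omega_*$ being lattice tetrahedra. It is compatible with the decompositions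 of the six bond volumes $B_{\ell\pm\eta_ie_i,\eta}$ sharing a face with it, where bond volumes of class (a) carry the type A decomposition and those of class (b) the decomposition into lattice tetrahedra. Let $y^{\ell,\eta}$ be the function on $\overline B_{\ell,\eta}$ that is affine on each $T\in\mathcal T(B_{\ell,\eta})$ and equals $y$ at the vertices. **Finite element space.** Let $\mathcal T_c(\Omega_*)$ be a conforming decomposition of $\Omega_*$ into tetrahedra with vertices in $\varepsilon\mathbb Z^3$, such that every element $T$ with $\overline T\cap\Gamma\ne\emptyset$ is a lattice tetrahedron. The space $\boldsymbol V_{h,ac}$ consists of all $v\in C(\Omega;\mathbb R^3)$, periodic with period $\Omega$, that are affine on every lattice tetrahedron contained in $\overline\Omega_a$ and on every $T\in\mathcal T_c(\Omega_*)$ with $\overline T\cap\Gamma\neq\emptyset$, and polynomial of total degree at most $k$ on every other $T\in\mathcal T_c(\Omega_*)$. **Energy.** For $y=\mathsf Fx+v$ with a $3\times3$ matrix $\mathsf F$, $\det\mathsf F>0$, and $v\in\boldsymbol V_{h,ac}$, put $$\mathcal E_h\{y\}=\sum_{\eta\in R}\Big[\varepsilon^3\!\!\sum_{\ell\in\mathfrak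 L,\ \overline B_{\ell,\eta}\subset\Omega_a}\!\!\phi_\eta(\overline D_\eta y_\ell)+\int_{\Omega_*}\phi_\eta(\nabla y\,\eta)\,dx+\sum_{\ell\in\mathfrak L,\ B_{\ell,\eta}\in B_\Gamma}\frac1{|\eta_1\eta_2\eta_3|}\int_{B_{\ell,\eta}}\chi_{\Omega_a}\phi_\eta(\nabla y^{\ell,\eta}\,\eta)\,dx\Big].$$ **Proposition.** The energy $\mathcal E_h$ is free of ghost forces: for $y_{\mathsf F}(x)=\mathsf Fx$ and every $v\in\boldsymbol V_{h,ac}$, $$\langle D\mathcal E_h(y_{\mathsf F}),v\rangle=\frac{d}{dt}\Big|_{t=0}\mathcal E_h\{y_{\mathsf F}+tv\}=0 .$$ -/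

import Mathlib

noncomputable section

namespace ACCoupling

/-- Points (and vectors) of `ℝ³`. Norms play no role below; the measure is Lebesgue measure. -/
abbrev Pt := Fin 3 → ℝ

/-- Points of the unscaled lattice `ℤ³`; bond vectors `η` also live here. -/
abbrev LPt := Fin 3 → ℤ

/-- The lattice distance `ε = 1 / N`. -/
def spacing (N : ℕ) : ℝ := 1 / (N : ℝ)

/-- The scaled lattice point `x_ℓ = ε ℓ`. -/
def latticePt (N : ℕ) (l : LPt) : Pt := fun i => spacing N * (l i : ℝ)

/-- A bond vector `η`, regarded as a vector of `ℝ³`. -/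
def toVec (η : LPt) : Pt := fun i => (η i : ℝ)

/-- The continuum domain `Ω = ∏ᵢ [-Mᵢ + 1, Mᵢ]`. -/
def domain (M : Fin 3 → ℕ) : Set Pt := {x | ∀ i, -(M i : ℝ) + 1 ≤ x i ∧ x i ≤ (M i : ℝ)}

/-- `𝔏 = ℤ³ ∩ (1/ε) Ω`. -/
def latticePeriod (N : ℕ) (M : Fin 3 → ℕ) : Finset LPt :=
  Fintype.piFinset fun i => Finset.Icc ((N : ℤ) * (-(M i : ℤ) + 1)) ((N : ℤ) * (M i : ℤ))

/-! ### Tetrahedra with lattice vertices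

A tetrahedron is represented by the finite set of its vertices `ℓ ∈ ℤ³`. -/

/-- The closed tetrahedron in `ℝ³` with vertices `x_ℓ`, `ℓ ∈ T` (a lower-dimensional simplex if `T`
has fewer elements, and the empty set if `T = ∅`). -/
def hull (N : ℕ) (T : Finset LPt) : Set Pt := convexHull ℝ (latticePt N '' (T : Set LPt))

/-- `T` consists of the four vertices of a nondegenerate tetrahedron. -/
def IsTetrahedron (N : ℕ) (T : Finset LPt) : Prop :=
  T.card = 4 ∧ AffineIndependent ℝ (fun p : T => latticePt N (p : LPt))

/-- Any tetrahedron of `𝒮` and any tetrahedron of `𝒯` intersect exactly in the common face spanned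
by their common vertices (which may be empty). -/
def Conforming (N : ℕ) (𝒮 𝒯 : Set (Finset LPt)) : Prop :=
  ∀ S ∈ 𝒮, ∀ T ∈ 𝒯, hull N S ∩ hull N T = hull N (S ∩ T)

/-- `𝒯` is a conforming decomposition of `U` into tetrahedra with lattice vertices. -/
structure IsDecomposition (N : ℕ) (𝒯 : Finset (Finset LPt)) (U : Set Pt) : Prop where
  tetrahedron : ∀ T ∈ 𝒯, IsTetrahedron N T
  conforming : Conforming N 𝒯 𝒯
  cover : ⋃ T ∈ 𝒯, hull N T = closure U

/-- The `j`-th vertex of a monotone edge path from `ℓ` to `ℓ + η` in the box with main diagonal from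
`ℓ` to `ℓ + η`; `σ i` is the position at which the coordinate `i` is switched. -/
def pathVertex (l η : LPt) (σ : Equiv.Perm (Fin 3)) (j : Fin 4) : LPt :=
  fun i => l i + if (σ i : ℕ) < (j : ℕ) then η i else 0

/-- The six tetrahedra of the type A decomposition of the box with main diagonal from `x_ℓ` to
`x_{ℓ+η}`: their edges are the edges of the box, the main diagonal, the three face diagonals
starting at `x_ℓ` and the three face diagonals starting at `x_{ℓ+η}`. -/
def typeA (l η : LPt) : Finset (Finset LPt) :=
  Finset.univ.image fun σ : Equiv.Perm (Fin 3) => Finset.univ.image (pathVertex l η σ)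

/-- `𝒯_T(U)`: the lattice tetrahedra contained in (the closure of) `U`, that is, the tetrahedra of
the type A decompositions of the lattice cells, whose main diagonals run from `x_ℓ` to
`x_{ℓ+(1,1,1)}`. -/
def latticeTets (N : ℕ) (U : Set Pt) : Set (Finset LPt) :=
  {T | (∃ l : LPt, T ∈ typeA l 1) ∧ hull N T ⊆ closure U}

/-! ### Atomistic region, continuum region, interface -/

/-- `U` is the interior of the closure of a union of lattice tetrahedra of `Ω`, and is connected. -/
def IsLatticeRegion (N : ℕ) (M : Fin 3 → ℕ) (U : Set Pt) : Prop :=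
  (∃ 𝒮 ⊆ latticeTets N (domain M), U = interior (closure (⋃ T ∈ 𝒮, hull N T))) ∧ IsConnected U

/-- The bond volume `B_{ℓ,η}`: the open box with main diagonal from `x_ℓ` to `x_{ℓ+η}`. -/
def bondVolume (N : ℕ) (η l : LPt) : Set Pt :=
  {x | ∀ i, min (latticePt N l i) (latticePt N (l + η) i) < x i ∧
    x i < max (latticePt N l i) (latticePt N (l + η) i)}

/-- The splitting of `Ω` into the atomistic region `Ωa` and the continuum region `Ωs` (`Ω_*`).
The last two fields say that the closure of `Ωa` lies in the interior of `Ω`, at a distance from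
`∂Ω` that no bond volume can bridge. -/
structure IsSplitting (N : ℕ) (M : Fin 3 → ℕ) (R : Finset LPt) (Ωa Ωs : Set Pt) : Prop where
  region_a : IsLatticeRegion N M Ωa
  region_s : IsLatticeRegion N M Ωs
  disjoint : Disjoint Ωa Ωs
  cover : domain M = closure Ωa ∪ closure Ωs
  interior_domain : closure Ωa ⊆ interior (domain M)
  distance : ∀ η ∈ R, ∀ l : LPt, (closure (bondVolume N η l) ∩ closure Ωa).Nonempty →
    closure (bondVolume N η l) ⊆ interior (domain M)

/-- The interface `Γ`. -/
def interface (Ωa Ωs : Set Pt) : Set Pt := closure Ωa ∩ closure Ωs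

/-! ### The three classes of bond volumes -/

/-- Class (a): the closure of the bond volume is contained in the atomistic region. -/
def InAtomistic (N : ℕ) (Ωa : Set Pt) (η l : LPt) : Prop :=
  closure (bondVolume N η l) ⊆ Ωa

/-- Class (b): the bond volume is contained in `Ω_*`. By periodic extension, a bond volume that is
not contained in `Ω` is counted in this class. -/
def InContinuum (N : ℕ) (M : Fin 3 → ℕ) (Ωs : Set Pt) (η l : LPt) : Prop :=
  bondVolume N η l ⊆ Ωs ∨ ¬ bondVolume N η l ⊆ domain M

/-- Class (c), `B_Γ`: all other bond volumes. -/
def AtInterface (N : ℕ) (M : Fin 3 → ℕ) (Ωa Ωs : Set Pt) (η l : LPt) : Prop :=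
  ¬ InAtomistic N Ωa η l ∧ ¬ InContinuum N M Ωs η l

/-! ### Decompositions of the bond volumes at the interface -/

open Classical in
/-- The decomposition attached to an arbitrary bond volume, given decompositions `dec η ℓ` for the
bond volumes of class (c): type A for class (a), the lattice tetrahedra for class (b). -/
def bondMesh (N : ℕ) (M : Fin 3 → ℕ) (Ωa Ωs : Set Pt)
    (dec : LPt → LPt → Finset (Finset LPt)) (η l : LPt) : Set (Finset LPt) :=
  if InAtomistic N Ωa η l then (typeA l η : Set (Finset LPt))
  else if InContinuum N M Ωs η l then latticeTets N (bondVolume N η l)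
  else (dec η l : Set (Finset LPt))

/-- Admissible decompositions `𝒯(B_{ℓ,η}) = dec η ℓ` of the bond volumes of class (c). -/
structure IsInterfaceDecomposition (N : ℕ) (M : Fin 3 → ℕ) (R : Finset LPt) (Ωa Ωs : Set Pt)
    (dec : LPt → LPt → Finset (Finset LPt)) : Prop where
  /-- Each bond volume of class (c) is decomposed conformingly into tetrahedra with lattice
  vertices. -/
  decomposition : ∀ η ∈ R, ∀ l, AtInterface N M Ωa Ωs η l →
    IsDecomposition N (dec η l) (bondVolume N η l)
  /-- No tetrahedron crosses the interface. -/
  resolves : ∀ η ∈ R, ∀ l, AtInterface N M Ωa Ωs η l → ∀ T ∈ dec η l,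
    hull N T ⊆ closure Ωa ∨ hull N T ⊆ closure Ωs
  /-- In `Ω_*` only tetrahedra of type A decompositions of lattice cells are used. -/
  continuum : ∀ η ∈ R, ∀ l, AtInterface N M Ωa Ωs η l → ∀ T ∈ dec η l,
    hull N T ⊆ closure Ωs → T ∈ latticeTets N Ωs
  /-- Compatibility with the decompositions of the bond volumes sharing a face with it. -/
  compatible : ∀ η ∈ R, ∀ l, AtInterface N M Ωa Ωs η l → ∀ i : Fin 3,
    Conforming N (dec η l) (bondMesh N M Ωa Ωs dec η (l + Pi.single i (η i))) ∧
    Conforming N (dec η l) (bondMesh N M Ωa Ωs dec η (l - Pi.single i (η i)))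

/-- `w` are barycentric coordinates of `x` with respect to the vertices of `T`. -/
def IsBarycentric (N : ℕ) (T : Finset LPt) (w : LPt → ℝ) (x : Pt) : Prop :=
  (∀ p ∈ T, 0 ≤ w p) ∧ ∑ p ∈ T, w p = 1 ∧ ∑ p ∈ T, w p • latticePt N p = x

open Classical in
/-- The piecewise linear interpolant of the lattice values `y(x_ℓ)`: it is affine on every
tetrahedron of `𝒯` and equals `y` at its vertices. (For a conforming `𝒯` the value does not depend
on the choice of a tetrahedron containing `x`; outside all tetrahedra the value is `0`.) -/
def interpolant (N : ℕ) (𝒯 : Finset (Finset LPt)) (y : Pt → Pt) (x : Pt) : Pt :=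
  if h : ∃ q : Finset LPt × (LPt → ℝ), q.1 ∈ 𝒯 ∧ IsBarycentric N q.1 q.2 x then
    ∑ p ∈ h.choose.1, h.choose.2 p • y (latticePt N p)
  else 0

/-! ### The finite element spaces -/

/-- `𝒯_c(Ω_*)`: a conforming decomposition of `Ω_*` into tetrahedra with lattice vertices, such that
all its elements touching `Γ` are lattice tetrahedra. -/
structure IsContinuumMesh (N : ℕ) (Ωa Ωs : Set Pt) (𝒯c : Finset (Finset LPt)) : Prop where
  decomposition : IsDecomposition N 𝒯c Ωs
  lattice_at_interface : ∀ T ∈ 𝒯c, (hull N T ∩ interface Ωa Ωs).Nonempty → T ∈ latticeTets N Ωs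

/-- `v` restricted to `S` is (componentwise) a polynomial of total degree at most `k`. -/
def IsPolyOn (k : ℕ) (v : Pt → Pt) (S : Set Pt) : Prop :=
  ∀ i : Fin 3, ∃ p : MvPolynomial (Fin 3) ℝ,
    p.totalDegree ≤ k ∧ ∀ x ∈ S, v x i = MvPolynomial.eval x p

/-- The high-order finite element space `V_{h,ac}(Ω_*)` on the continuum region. -/
structure MemContinuumSpace (N k : ℕ) (Ωa Ωs : Set Pt) (𝒯c : Finset (Finset LPt))
    (v : Pt → Pt) : Prop where
  continuous : ContinuousOn v (closure Ωs)
  linear : ∀ T ∈ 𝒯c, (hull N T ∩ interface Ωa Ωs).Nonempty → IsPolyOn 1 v (hull N T)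
  poly : ∀ T ∈ 𝒯c, ¬ (hull N T ∩ interface Ωa Ωs).Nonempty → IsPolyOn k v (hull N T)

/-- The coupled periodic space `V_{h,ac}`. Only the values of `v` on `Ω` are relevant. -/
structure MemCoupledSpace (N k : ℕ) (M : Fin 3 → ℕ) (Ωa Ωs : Set Pt)
    (𝒯c : Finset (Finset LPt)) (v : Pt → Pt) : Prop where
  continuous : ContinuousOn v (domain M)
  atomistic : ∀ T ∈ latticeTets N Ωa, IsPolyOn 1 v (hull N T)
  continuum : MemContinuumSpace N k Ωa Ωs 𝒯c v
  periodic : ∀ (i : Fin 3), ∀ x ∈ domain M,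
    x + Pi.single i (2 * (M i : ℝ) - 1) ∈ domain M →
      v (x + Pi.single i (2 * (M i : ℝ) - 1)) = v x

/-! ### The energy -/

/-- The difference quotient `D̄_η y_ℓ = (y_{ℓ+η} - y_ℓ) / ε`, where `y_ℓ = y(x_ℓ)`. -/
def diffQuot (N : ℕ) (η : LPt) (y : Pt → Pt) (l : LPt) : Pt :=
  (spacing N)⁻¹ • (y (latticePt N (l + η)) - y (latticePt N l))

open Classical in
/-- The contribution of the atomistic region, a sum over the bond volumes of class (a). -/
def energyAtomistic (N : ℕ) (M : Fin 3 → ℕ) (Ωa : Set Pt) (φ : Pt → ℝ) (η : LPt)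
    (y : Pt → Pt) : ℝ :=
  spacing N ^ 3 * ∑ l ∈ latticePeriod N M with InAtomistic N Ωa η l, φ (diffQuot N η y l)

/-- The Cauchy--Born contribution of the continuum region, `∫_{Ω_*} φ_η(∇y η) dx`. -/
def energyContinuum (Ωs : Set Pt) (φ : Pt → ℝ) (η : LPt) (y : Pt → Pt) : ℝ :=
  ∫ x in Ωs, φ (fderiv ℝ y x (toVec η))

open Classical in
/-- The contribution of the bond volumes of class (c), with `y^{ℓ,η}` the piecewise linear
interpolant of `{y_ℓ}` on the decomposition of the bond volume. -/
def energyInterface (N : ℕ) (M : Fin 3 → ℕ) (Ωa Ωs : Set Pt)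
    (dec : LPt → LPt → Finset (Finset LPt)) (φ : Pt → ℝ) (η : LPt) (y : Pt → Pt) : ℝ :=
  ∑ l ∈ latticePeriod N M with AtInterface N M Ωa Ωs η l,
    (1 / |((η 0 * η 1 * η 2 : ℤ) : ℝ)|) *
      ∫ x in bondVolume N η l, Ωa.indicator
        (fun x => φ (fderiv ℝ (interpolant N (dec η l) y) x (toVec η))) x

/-- The coupled energy `ℰ_h = ∑_{η ∈ R} ℰ_{h,η}`. -/
def coupledEnergy (N : ℕ) (M : Fin 3 → ℕ) (R : Finset LPt) (φ : LPt → Pt → ℝ) (Ωa Ωs : Set Pt)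
    (dec : LPt → LPt → Finset (Finset LPt)) (y : Pt → Pt) : ℝ :=
  ∑ η ∈ R, (energyAtomistic N M Ωa (φ η) η y + energyContinuum Ωs (φ η) η y +
    energyInterface N M Ωa Ωs dec (φ η) η y)

end ACCoupling

end

noncomputable section

namespace ACCoupling

open Set Filter Topology MeasureTheory
open scoped NNReal

/-! ### Lipschitz functions on finite closed covers -/

/-! At the homogeneous state every contribution of a bond direction `η` has a first variation of the
form Dφ_η(Fη) applied to an averaged strain of `v` along `η`, because the derivative of `φ η` is
taken at the same matrix-vector product everywhere. It therefore suffices to show, for each `η`,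
that the sum of these strains vanishes (`IsCoupledProblem.balance`).

Fix `η` and a residue `r` modulo `η`. The bond volumes with base points congruent to `r` tile space.
On the closed atomistic region take the interpolants of `v` on the bond volumes of this class, and
elsewhere take `v` itself. The result (`gluedField`) is single-valued: neighbouring decompositions
are compatible across faces, and on the interface `v` is affine on the lattice tetrahedra of the
continuum region. It is thus Lipschitz and periodic on `Ω`, so its gradient has mean zero. Splitting
that integral into the continuum region and the bond volumes of the class gives one identity per
residue (`integral_residue_class`).

Now sum over the |η₁η₂η₃| residues and divide by their number. The continuum integral receives
weight one, and an interface bond volume receives 1/|η₁η₂η₃|, as in the energy. In a class (a) bond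
volume the main diagonal is an edge of every type A tetrahedron, so the derivative along `η` is the
constant `diffQuot`; as the box has volume ε³|η₁η₂η₃|, division leaves the weight ε³. These are
exactly the strains in the balance. -/

theorem dist_le_of_finite_closed_cover {F : Type*} [PseudoMetricSpace F] {g : ℝ → F} {C b : ℝ}
    (𝒦 : Finset (Set ℝ)) :
    ∀ a, a ≤ b → (∀ K ∈ 𝒦, IsClosed K) →
      (∀ K ∈ 𝒦, ∀ x ∈ K, ∀ y ∈ K, dist (g x) (g y) ≤ C * |x - y|) →
      Icc a b ⊆ ⋃ K ∈ 𝒦, K → dist (g a) (g b) ≤ C * (b - a) := by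
  classical
  induction 𝒦 using Finset.strongInduction with
  | H 𝒦 ih =>
    intro a hab hcl hlip hcov
    have ha : a ∈ ⋃ K ∈ 𝒦, K := hcov ⟨le_rfl, hab⟩
    simp only [mem_iUnion] at ha
    obtain ⟨K, hK, haK⟩ := ha
    -- Let `c` be the last point of `[a, b]` in the set `K` containing `a`. The remaining sets cover
    -- `(c, b]` and, being closed and finite in number, also `c`; this allows induction on the
    -- family.
    have hcomp : IsCompact (K ∩ Icc a b) := isCompact_Icc.inter_left (hcl K hK)
    have hne : (K ∩ Icc a b).Nonempty := ⟨a, haK, le_rfl, hab⟩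
    obtain ⟨c, ⟨hcK, hca, hcb⟩, hmax⟩ := hcomp.exists_isGreatest hne
    have h1 : dist (g a) (g c) ≤ C * (c - a) := by
      have := hlip K hK a haK c hcK
      rwa [abs_sub_comm, abs_of_nonneg (sub_nonneg.2 hca)] at this
    rcases hcb.eq_or_lt with rfl | hcb'
    · exact h1
    have hcov' : Ioc c b ⊆ ⋃ K' ∈ 𝒦.erase K, K' := by
      intro x hx
      have hx' := hcov ⟨hca.trans hx.1.le, hx.2⟩
      simp only [mem_iUnion] at hx' ⊢
      obtain ⟨K', hK', hxK'⟩ := hx'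
      refine ⟨K', Finset.mem_erase.2 ⟨?_, hK'⟩, hxK'⟩
      rintro rfl
      exact absurd (hmax ⟨hxK', hca.trans hx.1.le, hx.2⟩) (not_le.2 hx.1)
    have hclosed : IsClosed (⋃ K' ∈ 𝒦.erase K, K') :=
      Set.Finite.isClosed_biUnion (Finset.finite_toSet _)
        fun K' hK' => hcl K' (Finset.mem_of_mem_erase hK')
    have hcov'' : Icc c b ⊆ ⋃ K' ∈ 𝒦.erase K, K' := by
      rw [← closure_Ioc hcb'.ne]
      exact closure_minimal hcov' hclosed
    have h2 := ih _ (Finset.erase_ssubset hK) c hcb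
      (fun K' hK' => hcl K' (Finset.mem_of_mem_erase hK'))
      (fun K' hK' => hlip K' (Finset.mem_of_mem_erase hK')) hcov''
    calc dist (g a) (g b) ≤ dist (g a) (g c) + dist (g c) (g b) := dist_triangle _ _ _
      _ ≤ C * (c - a) + C * (b - c) := add_le_add h1 h2
      _ = C * (b - a) := by ring

/-- By convexity the segment between two points stays in `s`, so the one-dimensional estimate
applies along it. The sum of the local constants dominates each of them. This turns piecewise
smoothness of a glued function into a global Lipschitz bound. -/
theorem exists_lipschitzOnWith_of_finite_closed_cover {E F : Type*} [NormedAddCommGroup E]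
    [NormedSpace ℝ E] [PseudoMetricSpace F] {f : E → F} {s : Set E} (hs : Convex ℝ s)
    {𝒦 : Set (Set E)} (hfin : 𝒦.Finite) (hcl : ∀ K ∈ 𝒦, IsClosed K)
    (hlip : ∀ K ∈ 𝒦, ∃ C, LipschitzOnWith C f K) (hcov : s ⊆ ⋃₀ 𝒦) :
    ∃ C, LipschitzOnWith C f s := by
  classical
  choose! c hc using hlip
  refine ⟨∑ K ∈ hfin.toFinset, c K, LipschitzOnWith.of_dist_le_mul fun x hx y hy => ?_⟩
  set C : ℝ≥0 := ∑ K ∈ hfin.toFinset, c K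
  have hcC : ∀ K ∈ 𝒦, c K ≤ C := fun K hK =>
    Finset.single_le_sum (f := c) (fun _ _ => zero_le) (hfin.mem_toFinset.2 hK)
  set γ : ℝ → E := fun t => AffineMap.lineMap x y t with hγ
  have hγc : Continuous γ := AffineMap.lineMap_continuous
  have hdist : ∀ t u, dist (γ t) (γ u) = |t - u| * dist x y := by
    intro t u
    rw [hγ, dist_lineMap_lineMap, Real.dist_eq]
  have key := dist_le_of_finite_closed_cover (g := f ∘ γ) (C := C * dist x y) (b := 1)
    (hfin.toFinset.image fun K => γ ⁻¹' K) 0 zero_le_one ?_ ?_ ?_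
  · simpa [hγ] using key
  · intro K hK
    obtain ⟨K', hK', rfl⟩ := Finset.mem_image.1 hK
    exact (hcl K' (hfin.mem_toFinset.1 hK')).preimage hγc
  · intro K hK t ht u hu
    obtain ⟨K', hK', rfl⟩ := Finset.mem_image.1 hK
    have h := (hc K' (hfin.mem_toFinset.1 hK')).dist_le_mul _ ht _ hu
    rw [hdist] at h
    have h2 : (c K' : ℝ) ≤ C := by exact_mod_cast hcC K' (hfin.mem_toFinset.1 hK')
    calc dist (f (γ t)) (f (γ u)) ≤ c K' * (|t - u| * dist x y) := h
      _ ≤ C * (|t - u| * dist x y) := by gcongr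
      _ = C * dist x y * |t - u| := by ring
  · intro t ht
    obtain ⟨K, hK, hmem⟩ := hcov (hs.lineMap_mem hx hy ht)
    simp only [mem_iUnion]
    exact ⟨γ ⁻¹' K, Finset.mem_image_of_mem _ (hfin.mem_toFinset.2 hK), hmem⟩

/-! ### Integrals of derivatives over a box -/

/-- Rademacher's theorem gives differentiability within `s`, and the frontier of a convex set is
null, so almost every point of `s` is interior. -/
theorem ae_differentiableAt_of_lipschitzOnWith_convex {n : ℕ} {F : Type*} [NormedAddCommGroup F]
    [NormedSpace ℝ F] [FiniteDimensional ℝ F] {f : (Fin n → ℝ) → F} {s : Set (Fin n → ℝ)}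
    {C : ℝ≥0} (hs : Convex ℝ s) (hf : LipschitzOnWith C f s) :
    ∀ᵐ x, x ∈ s → s ∈ 𝓝 x ∧ DifferentiableAt ℝ f x := by
  have h1 : ∀ᵐ x : Fin n → ℝ, x ∉ frontier s :=
    measure_eq_zero_iff_ae_notMem.1 (hs.addHaar_frontier volume)
  filter_upwards [h1, hf.ae_differentiableWithinAt_of_mem (μ := volume)] with x hx1 hx2 hxs
  have hnhds : s ∈ 𝓝 x := by
    rw [← mem_interior_iff_mem_nhds]
    by_contra h
    exact hx1 ⟨subset_closure hxs, h⟩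
  exact ⟨hnhds, (hx2 hxs).differentiableAt hnhds⟩

/-- Fubini in direction `i`, then the fundamental theorem of calculus for absolutely continuous
functions on each line; periodicity cancels the two end values. -/
theorem integral_fderiv_single_eq_zero {n : ℕ} {a b : Fin (n + 1) → ℝ} (i : Fin (n + 1))
    (hab : a i ≤ b i) {f : (Fin (n + 1) → ℝ) → ℝ} {C : ℝ≥0} (hf : LipschitzOnWith C f (Icc a b))
    (hper : ∀ z : Fin n → ℝ, i.insertNth (a i) z ∈ Icc a b →
      f (i.insertNth (b i) z) = f (i.insertNth (a i) z)) :
    ∫ x in Icc a b, fderiv ℝ f x (Pi.single i 1) = 0 := by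
  set e := MeasurableEquiv.piFinSuccAbove (fun _ : Fin (n + 1) => ℝ) i with he
  have hmp : MeasurePreserving e.symm :=
    (volume_preserving_piFinSuccAbove (fun _ : Fin (n + 1) => ℝ) i).symm _
  have hsymm : ∀ t z, e.symm (t, z) = i.insertNth t z := fun t z => rfl
  have hpre : e.symm ⁻¹' Icc a b =
      Icc (a i) (b i) ×ˢ Icc (fun j => a (i.succAbove j)) (fun j => b (i.succAbove j)) := by
    ext ⟨t, z⟩
    simp only [mem_preimage, hsymm, mem_prod, mem_Icc, Pi.le_def, Fin.forall_iff_succAbove i,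
      Fin.insertNth_apply_same, Fin.insertNth_apply_succAbove]
    tauto
  -- On almost every line the full derivative exists at almost every point, so the derivative of the
  -- restriction to the line is the directional derivative.
  have hae : ∀ᵐ z : Fin n → ℝ, ∀ᵐ t : ℝ, i.insertNth t z ∈ Icc a b →
      DifferentiableAt ℝ f (i.insertNth t z) := by
    have h1 := hmp.quasiMeasurePreserving.ae
      (ae_differentiableAt_of_lipschitzOnWith_convex (convex_Icc a b) hf)
    have h2 := (Measure.measurePreserving_swap (μ := (volume : Measure (Fin n → ℝ)))
      (ν := (volume : Measure ℝ))).quasiMeasurePreserving.ae h1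
    filter_upwards [Measure.ae_ae_of_ae_prod h2] with z hz
    filter_upwards [hz] with t ht hmem using (ht hmem).2
  have hint : IntegrableOn (fun x => fderiv ℝ f x (Pi.single i 1)) (Icc a b) := by
    refine Measure.integrableOn_of_bounded (M := C * ‖(Pi.single i 1 : Fin (n + 1) → ℝ)‖)
      isCompact_Icc.measure_lt_top.ne
      (measurable_fderiv_apply_const ℝ f _).aestronglyMeasurable ?_
    rw [ae_restrict_iff' measurableSet_Icc]
    filter_upwards [ae_differentiableAt_of_lipschitzOnWith_convex (convex_Icc a b) hf] with x hx hxs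
    refine (ContinuousLinearMap.le_opNorm _ _).trans ?_
    gcongr
    exact norm_fderiv_le_of_lipschitzOn ℝ (hx hxs).1 hf
  rw [← hmp.setIntegral_preimage_emb e.symm.measurableEmbedding, hpre]
  have hint' : IntegrableOn (fun p : ℝ × (Fin n → ℝ) => fderiv ℝ f (e.symm p) (Pi.single i 1))
      (Icc (a i) (b i) ×ˢ Icc (fun j => a (i.succAbove j)) (fun j => b (i.succAbove j)))
      (volume.prod volume) := by
    rw [← hpre]
    exact (hmp.integrableOn_comp_preimage e.symm.measurableEmbedding).2 hint
  rw [Measure.volume_eq_prod, ← Measure.prod_restrict, integral_prod_symm _ (by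
    rw [Measure.prod_restrict]; exact hint')]
  refine integral_eq_zero_of_ae ?_
  rw [EventuallyEq, ae_restrict_iff' measurableSet_Icc]
  filter_upwards [hae] with z hz hzs
  have hmem : ∀ t ∈ Icc (a i) (b i), (i.insertNth t z : Fin (n + 1) → ℝ) ∈ Icc a b := by
    intro t ht
    have : (t, z) ∈ e.symm ⁻¹' Icc a b := by rw [hpre]; exact ⟨ht, hzs⟩
    exact this
  have hline : ∀ t u : ℝ, (i.insertNth t z : Fin (n + 1) → ℝ) =
      i.insertNth u z + (t - u) • Pi.single i 1 := by
    intro t u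
    ext j
    refine Fin.succAboveCases i ?_ (fun k => ?_) j
    · simp
    · simp
  have hlip : LipschitzOnWith C (fun t : ℝ => f (i.insertNth t z)) (uIcc (a i) (b i)) := by
    rw [uIcc_of_le hab]
    refine LipschitzOnWith.of_dist_le_mul fun t ht u hu => ?_
    refine (hf.dist_le_mul _ (hmem t ht) _ (hmem u hu)).trans ?_
    gcongr
    rw [hline t u, dist_eq_norm, add_sub_cancel_left, norm_smul, Real.dist_eq, Real.norm_eq_abs]
    simp [Pi.norm_single]
  have hftc := hlip.absolutelyContinuousOnInterval.integral_deriv_eq_sub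
  rw [hper z (hmem _ ⟨le_rfl, hab⟩), sub_self, intervalIntegral.integral_of_le hab,
    ← integral_Icc_eq_integral_Ioc] at hftc
  rw [Pi.zero_apply, ← hftc]
  refine integral_congr_ae ?_
  rw [EventuallyEq, ae_restrict_iff' measurableSet_Icc]
  filter_upwards [hz] with t ht hts
  have hd := (ht (hmem t hts)).hasFDerivAt
  have hcurve : HasDerivAt (fun s : ℝ => (i.insertNth s z : Fin (n + 1) → ℝ)) (Pi.single i 1) t := by
    have : (fun s : ℝ => (i.insertNth s z : Fin (n + 1) → ℝ)) =
        fun s => i.insertNth t z + (s - t) • Pi.single i 1 := funext fun s => hline s t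
    rw [this]
    simpa using (((hasDerivAt_id t).sub_const t).smul_const
      (Pi.single i 1 : Fin (n + 1) → ℝ)).const_add (i.insertNth t z : Fin (n + 1) → ℝ)
  exact (hd.comp_hasDerivAt t hcurve).deriv.symm

/-! ### Differentiation of energies -/

/-- Differentiation under the integral. At `t = 0` the linear functional `fderiv ℝ φ A` no longer
depends on the point and can be pulled out, so only the mean of `G` matters. -/
theorem hasDerivAt_integral_comp_add_smul {α E : Type*} [MeasurableSpace α] {μ : Measure α}
    [IsFiniteMeasure μ] [NormedAddCommGroup E] [NormedSpace ℝ E] [FiniteDimensional ℝ E]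
    [MeasurableSpace E] [BorelSpace E] {φ : E → ℝ} (hφ : ContDiff ℝ 1 φ) (A : E) {G : α → E}
    (hG : Measurable G) {C : ℝ} (hC : ∀ᵐ x ∂μ, ‖G x‖ ≤ C) :
    HasDerivAt (fun t : ℝ => ∫ x, φ (A + t • G x) ∂μ) (fderiv ℝ φ A (∫ x, G x ∂μ)) 0 := by
  have : ProperSpace E := FiniteDimensional.proper ℝ E
  have hdc : Continuous (fderiv ℝ φ) := hφ.continuous_fderiv one_ne_zero
  have hGint : Integrable G μ :=
    Integrable.of_bound hG.aestronglyMeasurable C hC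
  -- For `|t| < 1` the arguments stay in this compact ball. The radius is `|C|` because the sign of
  -- `C` is not known when `μ` is zero.
  obtain ⟨D, hD⟩ : ∃ D, ∀ p ∈ Metric.closedBall A |C|, ‖fderiv ℝ φ p‖ ≤ D := by
    obtain ⟨D, hD⟩ := (isCompact_closedBall A |C|).exists_bound_of_continuousOn hdc.continuousOn
    exact ⟨D, hD⟩
  have hmeas : ∀ t : ℝ, Measurable fun x => A + t • G x := fun t =>
    (hG.const_smul t).const_add A
  have hC' : ∀ᵐ x ∂μ, ‖G x‖ ≤ |C| := hC.mono fun x hx => hx.trans (le_abs_self C)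
  have hconst : ∫ x, fderiv ℝ φ (A + (0 : ℝ) • G x) (G x) ∂μ = fderiv ℝ φ A (∫ x, G x ∂μ) := by
    simp only [zero_smul, add_zero]
    exact ContinuousLinearMap.integral_comp_comm _ hGint
  rw [← hconst]
  refine (hasDerivAt_integral_of_dominated_loc_of_deriv_le
    (F' := fun t x => fderiv ℝ φ (A + t • G x) (G x)) (bound := fun _ => D * |C|)
    (Metric.ball_mem_nhds (0 : ℝ) one_pos) ?_ ?_ ?_ ?_ (integrable_const _) ?_).2
  · exact Eventually.of_forall fun t =>
      (hφ.continuous.measurable.comp (hmeas t)).aestronglyMeasurable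
  · simp
  · simp only [zero_smul, add_zero]
    exact ((fderiv ℝ φ A).continuous.measurable.comp hG).aestronglyMeasurable
  · filter_upwards [hC'] with x hx t ht
    have hmem : A + t • G x ∈ Metric.closedBall A |C| := by
      rw [mem_closedBall_iff_norm, add_sub_cancel_left, norm_smul]
      have ht' : ‖t‖ ≤ 1 := (mem_ball_zero_iff.1 ht).le
      calc ‖t‖ * ‖G x‖ ≤ 1 * |C| := by gcongr
        _ = |C| := one_mul _
    refine (ContinuousLinearMap.le_opNorm _ _).trans ?_
    have := hD _ hmem
    gcongr
    exact (norm_nonneg _).trans this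
  · filter_upwards with x t ht
    have h1 : HasDerivAt (fun s : ℝ => A + s • G x) (G x) t := by
      simpa using ((hasDerivAt_id t).smul_const (G x)).const_add A
    exact ((hφ.differentiable one_ne_zero) _).hasFDerivAt.comp_hasDerivAt t h1

/-! ### Polynomials of low degree -/

theorem eval_sum_smul_of_totalDegree_le_one {σ ι : Type*} [Fintype σ] {p : MvPolynomial σ ℝ}
    (hp : p.totalDegree ≤ 1) (s : Finset ι) (w : ι → ℝ) (hw : ∑ i ∈ s, w i = 1)
    (x : ι → σ → ℝ) :
    MvPolynomial.eval (∑ i ∈ s, w i • x i) p = ∑ i ∈ s, w i * MvPolynomial.eval (x i) p := by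
  classical
  have hmono : ∀ d ∈ p.support, (∏ j, (∑ i ∈ s, w i • x i) j ^ d j) =
      ∑ i ∈ s, w i * ∏ j, x i j ^ d j := by
    intro d hd
    have hd1 : d.degree ≤ 1 := (MvPolynomial.le_totalDegree hd).trans hp
    rcases Nat.le_one_iff_eq_zero_or_eq_one.1 hd1 with h0 | h1
    · rw [Finsupp.degree_eq_zero_iff] at h0
      simp [h0, hw]
    · obtain ⟨j, rfl⟩ := (show d ∈ Set.range fun a : σ => Finsupp.single a 1 by
        rw [Finsupp.range_single_one]; exact h1)
      have : ∀ y : σ → ℝ, ∏ k, y k ^ (Finsupp.single j 1 : σ →₀ ℕ) k = y j := by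
        intro y
        rw [Finset.prod_eq_single j]
        · simp
        · intro k _ hk
          simp [Finsupp.single_eq_of_ne hk]
        · simp
      simp only [this, Finset.sum_apply, Pi.smul_apply, smul_eq_mul]
  simp only [MvPolynomial.eval_eq']
  rw [Finset.sum_congr rfl fun d hd => by rw [hmono d hd]]
  simp only [Finset.mul_sum]
  rw [Finset.sum_comm]
  refine Finset.sum_congr rfl fun i _ => Finset.sum_congr rfl fun d _ => by ring

theorem IsPolyOn.exists_lipschitzOnWith {k : ℕ} {v : Pt → Pt} {S : Set Pt} (hS : IsCompact S)
    (hv : IsPolyOn k v S) : ∃ C, LipschitzOnWith C v S := by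
  choose p hp hvp using hv
  have hcd : ContDiff ℝ 1 (fun x : Pt => fun i => MvPolynomial.eval x (p i)) := by
    rw [contDiff_pi]
    intro i
    exact (AnalyticOnNhd.eval_mvPolynomial (p i)).contDiff
  obtain ⟨C, hC⟩ := (LocallyLipschitz.locallyLipschitzOn (s := S)
    hcd.locallyLipschitz).exists_lipschitzOnWith_of_compact hS
  refine ⟨C, fun x hx y hy => ?_⟩
  have hval : ∀ z ∈ S, v z = fun i => MvPolynomial.eval z (p i) := fun z hz =>
    funext fun i => hvp i z hz
  rw [hval x hx, hval y hy]
  exact hC hx hy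

theorem IsPolyOn.sum_smul {v : Pt → Pt} {S : Set Pt} (hv : IsPolyOn 1 v S) {ι : Type*}
    (s : Finset ι) (w : ι → ℝ) (hw : ∑ i ∈ s, w i = 1) (x : ι → Pt) (hx : ∀ i ∈ s, x i ∈ S)
    (hmem : ∑ i ∈ s, w i • x i ∈ S) :
    v (∑ i ∈ s, w i • x i) = ∑ i ∈ s, w i • v (x i) := by
  ext j
  obtain ⟨p, hp, hvp⟩ := hv j
  rw [hvp _ hmem, eval_sum_smul_of_totalDegree_le_one hp s w hw]
  simp only [Finset.sum_apply, Pi.smul_apply, smul_eq_mul]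
  exact Finset.sum_congr rfl fun i hi => by rw [hvp _ (hx i hi)]

/-! ### Barycentric coordinates -/

theorem spacing_pos {N : ℕ} (hN : 0 < N) : 0 < spacing N := by
  unfold spacing; positivity

theorem latticePt_injective {N : ℕ} (hN : 0 < N) : Function.Injective (latticePt N) := by
  intro p q h
  ext i
  have := congrFun h i
  simp only [latticePt] at this
  exact_mod_cast mul_left_cancel₀ (spacing_pos hN).ne' this

theorem isCompact_hull (N : ℕ) (T : Finset LPt) : IsCompact (hull N T) :=
  (T.finite_toSet.image _).isCompact_convexHull ℝ

theorem isClosed_hull (N : ℕ) (T : Finset LPt) : IsClosed (hull N T) := (isCompact_hull N T).isClosed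

theorem convex_hull (N : ℕ) (T : Finset LPt) : Convex ℝ (hull N T) := convex_convexHull ℝ _

theorem latticePt_mem_hull {N : ℕ} {T : Finset LPt} {p : LPt} (hp : p ∈ T) :
    latticePt N p ∈ hull N T := subset_convexHull ℝ _ (mem_image_of_mem _ hp)

theorem mem_hull_iff {N : ℕ} (hN : 0 < N) {T : Finset LPt} {x : Pt} :
    x ∈ hull N T ↔ ∃ w, IsBarycentric N T w x := by
  classical
  unfold hull
  constructor
  · intro h
    rw [← Finset.coe_image, Finset.mem_convexHull'] at h
    obtain ⟨w, hw0, hw1, hwx⟩ := h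
    have hinj : Set.InjOn (latticePt N) (T : Set LPt) := (latticePt_injective hN).injOn
    rw [Finset.sum_image hinj] at hw1 hwx
    exact ⟨w ∘ latticePt N, fun p hp => hw0 _ (Finset.mem_image_of_mem _ hp), hw1, hwx⟩
  · rintro ⟨w, hw0, hw1, rfl⟩
    exact (convex_convexHull ℝ _).sum_mem hw0 hw1 fun p hp => latticePt_mem_hull hp

theorem IsTetrahedron.weights_eq {N : ℕ} {T : Finset LPt} (hT : IsTetrahedron N T)
    {w w' : LPt → ℝ} (hw : ∑ p ∈ T, w p = ∑ p ∈ T, w' p)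
    (hx : ∑ p ∈ T, w p • latticePt N p = ∑ p ∈ T, w' p • latticePt N p) :
    ∀ p ∈ T, w p = w' p := by
  intro p hp
  have h := (affineIndependent_iff.1 hT.2) Finset.univ (fun q => w q - w' q) ?_ ?_ ⟨p, hp⟩
    (Finset.mem_univ _)
  · exact sub_eq_zero.1 h
  · rw [Finset.sum_coe_sort T (fun q => w q - w' q), Finset.sum_sub_distrib, hw, sub_self]
  · rw [Finset.sum_coe_sort T (fun q => (w q - w' q) • latticePt N q)]
    simp only [sub_smul, Finset.sum_sub_distrib, hx, sub_self]

theorem IsTetrahedron.exists_affineMap {N : ℕ} {T : Finset LPt} (hT : IsTetrahedron N T)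
    (f : LPt → Pt) : ∃ A : Pt →ᵃ[ℝ] Pt, ∀ p ∈ T, A (latticePt N p) = f p := by
  have hcard : Fintype.card T = Module.finrank ℝ Pt + 1 := by
    simp [hT.1]
  let b : AffineBasis T ℝ Pt :=
    ⟨_, hT.2, hT.2.affineSpan_eq_top_iff_card_eq_finrank_add_one.2 hcard⟩
  let A : Pt →ᵃ[ℝ] Pt := ∑ q : T, (LinearMap.toSpanSingleton ℝ Pt (f q)).toAffineMap.comp (b.coord q)
  refine ⟨A, fun p hp => ?_⟩
  have hb : latticePt N p = b ⟨p, hp⟩ := rfl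
  have : A (latticePt N p) = ∑ q : T, (b.coord q (b ⟨p, hp⟩)) • f q := by
    rw [hb]
    simp only [A]
    rw [show ((∑ q : T, (LinearMap.toSpanSingleton ℝ Pt (f q)).toAffineMap.comp (b.coord q) :
      Pt →ᵃ[ℝ] Pt) (b ⟨p, hp⟩)) = ∑ q : T, (((LinearMap.toSpanSingleton ℝ Pt
        (f q)).toAffineMap.comp (b.coord q) : Pt →ᵃ[ℝ] Pt) (b ⟨p, hp⟩)) from
      map_sum (AddMonoidHom.mk' (fun g : Pt →ᵃ[ℝ] Pt => g (b ⟨p, hp⟩)) (fun _ _ => rfl)) _ _]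
    simp
  rw [this, Finset.sum_eq_single ⟨p, hp⟩]
  · simp
  · intro q _ hq
    rw [b.coord_apply_ne hq, zero_smul]
  · simp

theorem AffineMap.map_sum_smul {N : ℕ} (A : Pt →ᵃ[ℝ] Pt) {T : Finset LPt} {w : LPt → ℝ}
    (hw : ∑ p ∈ T, w p = 1) :
    A (∑ p ∈ T, w p • latticePt N p) = ∑ p ∈ T, w p • A (latticePt N p) := by
  rw [← Finset.affineCombination_eq_linear_combination T _ _ hw, Finset.map_affineCombination _ _ _ hw,
    Finset.affineCombination_eq_linear_combination T _ _ hw]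
  rfl

/-- The interpolated values of lattice functions on `𝒮` and on `𝒯` agree at all common points. -/
def Agree (N : ℕ) (𝒮 𝒯 : Set (Finset LPt)) : Prop :=
  ∀ S ∈ 𝒮, ∀ T ∈ 𝒯, ∀ w w' x, IsBarycentric N S w x → IsBarycentric N T w' x →
    ∀ f : LPt → Pt, ∑ p ∈ S, w p • f p = ∑ p ∈ T, w' p • f p

theorem Agree.symm {N : ℕ} {𝒮 𝒯 : Set (Finset LPt)} (h : Agree N 𝒮 𝒯) : Agree N 𝒯 𝒮 :=
  fun T hT S hS w w' x hw hw' f => (h S hS T hT w' w x hw' hw f).symm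

/-- A common point lies in the hull of the common vertices. By uniqueness of barycentric
coordinates, both sets of weights are the extension by zero of its weights on that common face. -/
theorem Conforming.agree {N : ℕ} (hN : 0 < N) {𝒮 𝒯 : Set (Finset LPt)} (h : Conforming N 𝒮 𝒯)
    (h𝒮 : ∀ S ∈ 𝒮, IsTetrahedron N S) (h𝒯 : ∀ T ∈ 𝒯, IsTetrahedron N T) : Agree N 𝒮 𝒯 := by
  classical
  have key : ∀ (S U : Finset LPt), IsTetrahedron N S → U ⊆ S → ∀ w u x, IsBarycentric N S w x →
      IsBarycentric N U u x → ∀ f : LPt → Pt, ∑ p ∈ S, w p • f p = ∑ p ∈ U, u p • f p := by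
    intro S U hS hUS w u x hw hu f
    have hext : ∀ {V : Type} [AddCommGroup V] [Module ℝ V] (g : LPt → V),
        ∑ p ∈ S, (if p ∈ U then u p else 0) • g p = ∑ p ∈ U, u p • g p := by
      intro V _ _ g
      simp only [ite_smul, zero_smul]
      rw [← Finset.sum_filter, Finset.filter_mem_eq_inter, Finset.inter_eq_right.2 hUS]
    have hsum : ∑ p ∈ S, w p = ∑ p ∈ S, (if p ∈ U then u p else 0) := by
      rw [hw.2.1, ← hu.2.1]
      simpa using (hext (fun _ => (1 : ℝ))).symm
    have heq := hS.weights_eq hsum (by rw [hw.2.2, hext, hu.2.2])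
    rw [← hext]
    exact Finset.sum_congr rfl fun p hp => by rw [heq p hp]
  intro S hS T hT w w' x hw hw' f
  have hx : x ∈ hull N (S ∩ T) := by
    have := h S hS T hT
    rw [← this]
    exact ⟨(mem_hull_iff hN).2 ⟨w, hw⟩, (mem_hull_iff hN).2 ⟨w', hw'⟩⟩
  obtain ⟨u, hu⟩ := (mem_hull_iff hN).1 hx
  rw [key S _ (h𝒮 S hS) Finset.inter_subset_left w u x hw hu f,
    key T _ (h𝒯 T hT) Finset.inter_subset_right w' u x hw' hu f]

theorem interpolant_eq {N : ℕ} {𝒯 : Finset (Finset LPt)} (h : Agree N 𝒯 𝒯) {T : Finset LPt}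
    (hT : T ∈ 𝒯) {w : LPt → ℝ} {x : Pt} (hw : IsBarycentric N T w x) (y : Pt → Pt) :
    interpolant N 𝒯 y x = ∑ p ∈ T, w p • y (latticePt N p) := by
  have hex : ∃ q : Finset LPt × (LPt → ℝ), q.1 ∈ 𝒯 ∧ IsBarycentric N q.1 q.2 x :=
    ⟨(T, w), hT, hw⟩
  unfold interpolant
  rw [dif_pos hex]
  exact h _ hex.choose_spec.1 _ hT _ _ x hex.choose_spec.2 hw fun p => y (latticePt N p)

/-- The tetrahedron and weights chosen in `interpolant` depend on `x` and `𝒯` only, so interpolation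
is linear in the function without conformity; barycentric weights reproduce linear maps. -/
theorem interpolant_mulVec_add {N : ℕ} (hN : 0 < N) {𝒯 : Finset (Finset LPt)} {x : Pt}
    (hx : ∃ T ∈ 𝒯, x ∈ hull N T) (F : Matrix (Fin 3) (Fin 3) ℝ) (t : ℝ) (v : Pt → Pt) :
    interpolant N 𝒯 (fun x => F.mulVec x + t • v x) x = F.mulVec x + t • interpolant N 𝒯 v x := by
  obtain ⟨T, hT, hxT⟩ := hx
  obtain ⟨w, hw⟩ := (mem_hull_iff hN).1 hxT
  have hex : ∃ q : Finset LPt × (LPt → ℝ), q.1 ∈ 𝒯 ∧ IsBarycentric N q.1 q.2 x :=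
    ⟨(T, w), hT, hw⟩
  unfold interpolant
  rw [dif_pos hex, dif_pos hex]
  simp only [smul_add, Finset.sum_add_distrib]
  congr 1
  · conv_rhs => rw [← hex.choose_spec.2.2.2]
    rw [← Matrix.mulVecLin_apply, map_sum]
    simp
  · rw [Finset.smul_sum]
    exact Finset.sum_congr rfl fun p _ => smul_comm _ _ _

/-! ### Coordinates relative to a bond volume -/

/-- The coordinates of `x` in the box from `x_ℓ` to `x_{ℓ+η}`, scaled to the unit cube. -/
def relCoord (N : ℕ) (η l : LPt) (x : Pt) : Fin 3 → ℝ :=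
  fun i => (x i / spacing N - l i) / η i

theorem eq_of_relCoord {N : ℕ} (hN : 0 < N) {η : LPt} (hη : ∀ i, η i ≠ 0) (l : LPt) (x : Pt)
    (i : Fin 3) : x i = spacing N * (l i + η i * relCoord N η l x i) := by
  have h1 := (spacing_pos hN).ne'
  have h2 : (η i : ℝ) ≠ 0 := by exact_mod_cast hη i
  simp only [relCoord]
  field_simp
  ring

theorem relCoord_add_mul {N : ℕ} {η : LPt} (hη : ∀ i, η i ≠ 0) (l m : LPt) (x : Pt)
    (i : Fin 3) : relCoord N η (l + η * m) x i = relCoord N η l x i - m i := by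
  have h2 : (η i : ℝ) ≠ 0 := by exact_mod_cast hη i
  simp only [relCoord, Pi.add_apply, Pi.mul_apply]
  push_cast
  field_simp
  ring

theorem bondVolume_eq_pi (N : ℕ) (η l : LPt) : bondVolume N η l = Set.pi univ fun i =>
    Ioo (min (latticePt N l i) (latticePt N (l + η) i))
      (max (latticePt N l i) (latticePt N (l + η) i)) := by
  ext x
  simp [bondVolume]

theorem isOpen_bondVolume (N : ℕ) (η l : LPt) : IsOpen (bondVolume N η l) := by
  rw [bondVolume_eq_pi]
  exact isOpen_set_pi finite_univ fun i _ => isOpen_Ioo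

theorem latticePt_add (N : ℕ) (l η : LPt) (i : Fin 3) :
    latticePt N (l + η) i = latticePt N l i + spacing N * η i := by
  simp [latticePt, mul_add]

theorem mem_bondVolume_iff {N : ℕ} (hN : 0 < N) {η : LPt} (hη : ∀ i, η i ≠ 0) {l : LPt} {x : Pt} :
    x ∈ bondVolume N η l ↔ ∀ i, 0 < relCoord N η l x i ∧ relCoord N η l x i < 1 := by
  have hε := spacing_pos hN
  refine forall_congr' fun i => ?_
  rw [latticePt_add, eq_of_relCoord hN hη l x i]
  simp only [latticePt]
  generalize relCoord N η l x i = t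
  rw [mul_add]
  rcases lt_or_gt_of_ne (hη i) with h | h
  · have h' : (η i : ℝ) < 0 := by exact_mod_cast h
    have h2 : spacing N * (η i : ℝ) < 0 := mul_neg_of_pos_of_neg hε h'
    rw [min_eq_right (by linarith), max_eq_left (by linarith), ← mul_assoc]
    constructor
    · rintro ⟨h3, h4⟩
      constructor <;> nlinarith
    · rintro ⟨h3, h4⟩
      constructor <;> nlinarith
  · have h' : (0 : ℝ) < η i := by exact_mod_cast h
    have h2 : 0 < spacing N * (η i : ℝ) := mul_pos hε h'
    rw [min_eq_left (by linarith), max_eq_right (by linarith), ← mul_assoc]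
    constructor
    · rintro ⟨h3, h4⟩
      constructor <;> nlinarith
    · rintro ⟨h3, h4⟩
      constructor <;> nlinarith

theorem closure_bondVolume {N : ℕ} (hN : 0 < N) {η : LPt} (hη : ∀ i, η i ≠ 0) (l : LPt) :
    closure (bondVolume N η l) = Set.pi univ fun i =>
      Icc (min (latticePt N l i) (latticePt N (l + η) i))
        (max (latticePt N l i) (latticePt N (l + η) i)) := by
  have hε := spacing_pos hN
  rw [bondVolume_eq_pi, closure_pi_set]
  congr 1
  ext1 i
  refine closure_Ioo (min_lt_max.2 ?_).ne
  rw [latticePt_add]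
  have h2 : (η i : ℝ) ≠ 0 := by exact_mod_cast hη i
  have := mul_ne_zero hε.ne' h2
  intro h
  apply this
  linarith

theorem mem_closure_bondVolume_iff {N : ℕ} (hN : 0 < N) {η : LPt} (hη : ∀ i, η i ≠ 0) {l : LPt}
    {x : Pt} : x ∈ closure (bondVolume N η l) ↔
      ∀ i, 0 ≤ relCoord N η l x i ∧ relCoord N η l x i ≤ 1 := by
  have hε := spacing_pos hN
  rw [closure_bondVolume hN hη, mem_univ_pi]
  refine forall_congr' fun i => ?_
  rw [latticePt_add, eq_of_relCoord hN hη l x i]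
  simp only [latticePt, mem_Icc]
  generalize relCoord N η l x i = t
  rw [mul_add]
  rcases lt_or_gt_of_ne (hη i) with h | h
  · have h' : (η i : ℝ) < 0 := by exact_mod_cast h
    have h2 : spacing N * (η i : ℝ) < 0 := mul_neg_of_pos_of_neg hε h'
    rw [min_eq_right (by linarith), max_eq_left (by linarith), ← mul_assoc]
    constructor
    · rintro ⟨h3, h4⟩
      constructor <;> nlinarith
    · rintro ⟨h3, h4⟩
      constructor <;> nlinarith
  · have h' : (0 : ℝ) < η i := by exact_mod_cast h
    have h2 : 0 < spacing N * (η i : ℝ) := mul_pos hε h'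
    rw [min_eq_left (by linarith), max_eq_right (by linarith), ← mul_assoc]
    constructor
    · rintro ⟨h3, h4⟩
      constructor <;> nlinarith
    · rintro ⟨h3, h4⟩
      constructor <;> nlinarith

theorem convex_closure_bondVolume (N : ℕ) (η l : LPt) : Convex ℝ (closure (bondVolume N η l)) := by
  rw [bondVolume_eq_pi]
  exact (convex_pi fun i _ => convex_Ioo _ _).closure

/-! ### Type A decompositions -/

theorem pathVertex_injective {η : LPt} (hη : ∀ i, η i ≠ 0) (l : LPt) (σ : Equiv.Perm (Fin 3)) :
    Function.Injective (pathVertex l η σ) := by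
  have key : ∀ j k : Fin 4, j < k → pathVertex l η σ j ≠ pathVertex l η σ k := by
    intro j k hjk h
    have hj : (j : ℕ) < 3 := by omega
    have := congrFun h (σ.symm ⟨j, hj⟩)
    simp [pathVertex, hjk] at this
    exact hη _ this
  intro j k h
  rcases lt_trichotomy j k with hjk | hjk | hjk
  · exact absurd h (key j k hjk)
  · exact hjk
  · exact absurd h.symm (key k j hjk)

theorem sum_pathVertex {η : LPt} (hη : ∀ i, η i ≠ 0) (l : LPt) (σ : Equiv.Perm (Fin 3))
    {V : Type*} [AddCommMonoid V] (g : LPt → V) :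
    ∑ p ∈ Finset.univ.image (pathVertex l η σ), g p = ∑ j, g (pathVertex l η σ j) :=
  Finset.sum_image (pathVertex_injective hη l σ).injOn

theorem sum_smul_pathVertex {N : ℕ} {η : LPt} (l : LPt) (σ : Equiv.Perm (Fin 3))
    (u : Fin 4 → ℝ) (i : Fin 3) :
    (∑ j, u j • latticePt N (pathVertex l η σ j)) i =
      spacing N * ((∑ j, u j) * l i + η i * ∑ j : Fin 4, if (σ i : ℕ) < j then u j else 0) := by
  simp only [Finset.sum_apply, Pi.smul_apply, smul_eq_mul, latticePt, pathVertex, Finset.mul_sum,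
    Finset.sum_mul, ← Finset.sum_add_distrib]
  refine Finset.sum_congr rfl fun j _ => ?_
  split_ifs <;> push_cast <;> ring

theorem isBarycentric_path_iff {N : ℕ} (hN : 0 < N) {η : LPt} (hη : ∀ i, η i ≠ 0) {l : LPt}
    {σ : Equiv.Perm (Fin 3)} {w : LPt → ℝ} {x : Pt} :
    IsBarycentric N (Finset.univ.image (pathVertex l η σ)) w x ↔
      (∀ j, 0 ≤ w (pathVertex l η σ j)) ∧ ∑ j, w (pathVertex l η σ j) = 1 ∧
      ∀ i, relCoord N η l x i =
        ∑ j : Fin 4, if (σ i : ℕ) < j then w (pathVertex l η σ j) else 0 := by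
  unfold IsBarycentric
  rw [sum_pathVertex hη, sum_pathVertex hη]
  simp only [Finset.mem_image, Finset.mem_univ, true_and, forall_exists_index,
    forall_apply_eq_imp_iff]
  refine and_congr_right fun _ => and_congr_right fun h1 => ?_
  rw [funext_iff]
  refine forall_congr' fun i => ?_
  rw [sum_smul_pathVertex, h1, eq_of_relCoord hN hη l x i, one_mul]
  have h3 : (η i : ℝ) ≠ 0 := by exact_mod_cast hη i
  constructor
  · intro h
    have := mul_left_cancel₀ (spacing_pos hN).ne' h
    exact (mul_left_cancel₀ h3 (add_left_cancel this)).symm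
  · intro h
    rw [h]

theorem typeA_isTetrahedron {N : ℕ} (hN : 0 < N) {η : LPt} (hη : ∀ i, η i ≠ 0) {l : LPt}
    {T : Finset LPt} (hT : T ∈ typeA l η) : IsTetrahedron N T := by
  obtain ⟨σ, -, rfl⟩ := Finset.mem_image.1 hT
  refine ⟨?_, ?_⟩
  · rw [Finset.card_image_of_injective _ (pathVertex_injective hη l σ)]
    simp
  · have hind : AffineIndependent ℝ fun j => latticePt N (pathVertex l η σ j) := by
      rw [affineIndependent_iff_of_fintype]
      intro u hu hux
      rw [Finset.weightedVSub_eq_linear_combination _ hu] at hux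
      have h3 : ∀ i, ∑ j : Fin 4, (if (σ i : ℕ) < j then u j else 0) = 0 := by
        intro i
        have := congrFun hux i
        rw [sum_smul_pathVertex, hu] at this
        have h4 : (η i : ℝ) ≠ 0 := by exact_mod_cast hη i
        simpa [(spacing_pos hN).ne', h4] using this
      have h0 := h3 (σ.symm 0)
      have h1 := h3 (σ.symm 1)
      have h2 := h3 (σ.symm 2)
      simp [Fin.sum_univ_four] at h0 h1 h2 hu
      intro j
      fin_cases j <;> simp <;> linarith
    have hr : Set.range (fun j => latticePt N (pathVertex l η σ j)) =
        Set.range (fun p : (Finset.univ.image (pathVertex l η σ) : Finset LPt) =>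
          latticePt N (p : LPt)) := by
      ext x
      simp
    have h5 := hind.range
    rw [hr] at h5
    exact AffineIndependent.of_set_of_injective h5
      ((latticePt_injective hN).comp Subtype.val_injective)

theorem integral_eq_smul_of_eq_on_Ioo {a b : ℝ} (hab : a ≤ b) {g : ℝ → Pt} {c : Pt}
    (h : ∀ s ∈ Ioo a b, g s = c) :
    IntervalIntegrable g volume a b ∧ ∫ s in a..b, g s = (b - a) • c := by
  have hae : ∀ᵐ s ∂(volume.restrict (Ioc a b)), c = g s := by
    rw [← Measure.restrict_congr_set Ioo_ae_eq_Ioc, ae_restrict_iff' measurableSet_Ioo]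
    exact Eventually.of_forall fun s hs => (h s hs).symm
  constructor
  · rw [intervalIntegrable_iff_integrableOn_Ioc_of_le hab]
    exact (integrableOn_const (by simp)).congr hae
  · rw [intervalIntegral.integral_of_le hab, ← integral_congr_ae hae]
    simp [Real.volume_real_Ioc_of_le hab]

/-- Averaging the values of a lattice function over the integer parts of the translates of the
relative coordinates. On type A tetrahedra this is piecewise linear interpolation. -/
def floorAverage (N : ℕ) (η l : LPt) (f : LPt → Pt) (x : Pt) : Pt :=
  ∫ s in (0 : ℝ)..1, f fun i => l i + η i * ⌊relCoord N η l x i + s⌋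

theorem floorAverage_add_mul {N : ℕ} {η : LPt} (hη : ∀ i, η i ≠ 0) (l m : LPt) (f : LPt → Pt)
    (x : Pt) : floorAverage N η (l + η * m) f x = floorAverage N η l f x := by
  unfold floorAverage
  congr 1
  ext1 s
  congr 1
  ext1 i
  rw [relCoord_add_mul hη, sub_add_eq_add_sub, Int.floor_sub_intCast, Pi.add_apply, Pi.mul_apply]
  ring

/-- The floor of the `i`-th relative coordinate plus `s` jumps from 0 to 1 when `s` passes the sum
of the weights of the path vertices at which coordinate `i` is not yet switched. As `s` runs through
`(0, 1)`, the argument of `f` thus follows the monotone path and stays at its `j`-th vertex for a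
time equal to the weight of that vertex. -/
theorem floorAverage_eq {N : ℕ} (hN : 0 < N) {η : LPt} (hη : ∀ i, η i ≠ 0) {l : LPt}
    {T : Finset LPt} (hT : T ∈ typeA l η) {w : LPt → ℝ} {x : Pt} (hw : IsBarycentric N T w x)
    (f : LPt → Pt) : floorAverage N η l f x = ∑ p ∈ T, w p • f p := by
  obtain ⟨σ, -, rfl⟩ := Finset.mem_image.1 hT
  rw [isBarycentric_path_iff hN hη] at hw
  rw [sum_pathVertex hη]
  obtain ⟨h0, h1, hx⟩ := hw
  set P := pathVertex l η σ with hP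
  have hw0 := h0 0
  have hw1 := h0 1
  have hw2 := h0 2
  have hw3 := h0 3
  rw [Fin.sum_univ_four] at h1
  have hval : ∀ (j : Fin 4) (s : ℝ), 0 < s → s < 1 →
      (∀ i, (σ i : ℕ) < j → 1 ≤ relCoord N η l x i + s) →
      (∀ i, ¬ (σ i : ℕ) < j → relCoord N η l x i + s < 1) →
      (∀ i, 0 ≤ relCoord N η l x i ∧ relCoord N η l x i ≤ 1) →
      (fun i => l i + η i * ⌊relCoord N η l x i + s⌋) = P j := by
    intro j s hs0 hs1 hlt hge hb
    ext i
    simp only [hP, pathVertex]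
    congr 1
    have := hb i
    split_ifs with h
    · have h2 : ⌊relCoord N η l x i + s⌋ = 1 :=
        Int.floor_eq_iff.2 ⟨by simpa using hlt i h, by push_cast; linarith⟩
      rw [h2, mul_one]
    · have h2 : ⌊relCoord N η l x i + s⌋ = 0 :=
        Int.floor_eq_iff.2 ⟨by push_cast; linarith, by simpa using hge i h⟩
      rw [h2, mul_zero]
  have hσ : ∀ i, (σ i = 0 ∧ relCoord N η l x i = w (P 1) + w (P 2) + w (P 3)) ∨
      (σ i = 1 ∧ relCoord N η l x i = w (P 2) + w (P 3)) ∨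
      (σ i = 2 ∧ relCoord N η l x i = w (P 3)) := by
    intro i
    have hxi := hx i
    generalize σ i = k at *
    fin_cases k <;> simp [Fin.sum_univ_four] at hxi ⊢ <;> exact hxi
  have hb : ∀ i, 0 ≤ relCoord N η l x i ∧ relCoord N η l x i ≤ 1 := by
    intro i
    rcases hσ i with h | h | h <;> constructor <;> linarith [h.2]
  have step : ∀ (j : Fin 4) (a b : ℝ), 0 ≤ a → b ≤ 1 → a ≤ b →
      (∀ i, (σ i : ℕ) < j → 1 ≤ relCoord N η l x i + a) →
      (∀ i, ¬ (σ i : ℕ) < j → relCoord N η l x i + b ≤ 1) →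
      IntervalIntegrable (fun s => f fun i => l i + η i * ⌊relCoord N η l x i + s⌋) volume a b ∧
      ∫ s in a..b, (f fun i => l i + η i * ⌊relCoord N η l x i + s⌋) = (b - a) • f (P j) := by
    intro j a b ha hb1 hab hlt hge
    refine integral_eq_smul_of_eq_on_Ioo hab fun s hs => ?_
    rw [hval j s (ha.trans_lt hs.1) (hs.2.trans_le hb1) (fun i hi => by linarith [hlt i hi, hs.1])
      (fun i hi => by linarith [hge i hi, hs.2]) hb]
  -- The breakpoints are the partial sums of the weights; the last interval ends at 1 because the
  -- weights sum to 1.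
  have s0 := step 0 0 (w (P 0)) le_rfl (by linarith) hw0 (by simp) (fun i _ => by
    rcases hσ i with h | h | h <;> linarith [h.2])
  have s1 := step 1 (w (P 0)) (w (P 0) + w (P 1)) hw0 (by linarith) (by linarith)
    (fun i hi => by
      rcases hσ i with h | h | h
      · linarith [h.2]
      · simp [h.1] at hi
      · simp [h.1] at hi)
    (fun i hi => by
      rcases hσ i with h | h | h
      · simp [h.1] at hi
      · linarith [h.2]
      · linarith [h.2])
  have s2 := step 2 (w (P 0) + w (P 1)) (w (P 0) + w (P 1) + w (P 2)) (by linarith) (by linarith)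
    (by linarith)
    (fun i hi => by
      rcases hσ i with h | h | h
      · linarith [h.2]
      · linarith [h.2]
      · simp [h.1] at hi)
    (fun i hi => by
      rcases hσ i with h | h | h
      · simp [h.1] at hi
      · simp [h.1] at hi
      · linarith [h.2])
  have s3 := step 3 (w (P 0) + w (P 1) + w (P 2)) 1 (by linarith) le_rfl
    (by linarith)
    (fun i hi => by
      rcases hσ i with h | h | h <;> linarith [h.2])
    (fun i hi => by
      rcases hσ i with h | h | h <;> simp [h.1] at hi)
  unfold floorAverage
  rw [← intervalIntegral.integral_add_adjacent_intervals s0.1 (s1.1.trans (s2.1.trans s3.1)),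
    ← intervalIntegral.integral_add_adjacent_intervals s1.1 (s2.1.trans s3.1),
    ← intervalIntegral.integral_add_adjacent_intervals s2.1 s3.1, s0.2, s1.2, s2.2, s3.2,
    Fin.sum_univ_four, show 1 - (w (P 0) + w (P 1) + w (P 2)) = w (P 3) by linarith, sub_zero,
    add_sub_cancel_left, add_sub_cancel_left]
  abel

/-- Both interpolated values equal `floorAverage`, which ignores the path and is unchanged under
shifts by multiples of `η`. This avoids any case analysis of how two tetrahedra meet. -/
theorem agree_typeA {N : ℕ} (hN : 0 < N) {η : LPt} (hη : ∀ i, η i ≠ 0) (l m : LPt) :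
    Agree N (typeA l η) (typeA (l + η * m) η) := by
  intro S hS T hT w w' x hw hw' f
  rw [← floorAverage_eq hN hη hS hw, ← floorAverage_eq hN hη hT hw', floorAverage_add_mul hη]

theorem agree_typeA_self {N : ℕ} (hN : 0 < N) {η : LPt} (hη : ∀ i, η i ≠ 0) (l : LPt) :
    Agree N (typeA l η) (typeA l η) := by
  have := agree_typeA hN hη l 0
  rwa [mul_zero, add_zero] at this

/-- Sorting the relative coordinates in decreasing order selects the monotone path, and the
successive gaps from 1 down to 0 are the barycentric coordinates. -/
theorem exists_typeA_mem_hull {N : ℕ} (hN : 0 < N) {η : LPt} (hη : ∀ i, η i ≠ 0) {l : LPt}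
    {x : Pt} (hx : x ∈ closure (bondVolume N η l)) : ∃ T ∈ typeA l η, x ∈ hull N T := by
  rw [mem_closure_bondVolume_iff hN hη] at hx
  set t := relCoord N η l x with ht
  set ρ := Tuple.sort fun i => -t i with hρ
  have hmono := Tuple.monotone_sort fun i => -t i
  rw [← hρ] at hmono
  have h01 : t (ρ 1) ≤ t (ρ 0) := neg_le_neg_iff.1 (hmono (show (0 : Fin 3) ≤ 1 by decide))
  have h12 : t (ρ 2) ≤ t (ρ 1) := neg_le_neg_iff.1 (hmono (show (1 : Fin 3) ≤ 2 by decide))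
  set u : Fin 4 → ℝ := ![1 - t (ρ 0), t (ρ 0) - t (ρ 1), t (ρ 1) - t (ρ 2), t (ρ 2)] with hu
  -- The path is that of `ρ.symm`, since `pathVertex` expects the position of a coordinate in the
  -- order, whereas `ρ` lists the coordinates by position.
  refine ⟨_, Finset.mem_image_of_mem _ (Finset.mem_univ ρ.symm), (mem_hull_iff hN).2
    ⟨fun p => u (Function.invFun (pathVertex l η ρ.symm) p), ?_⟩⟩
  rw [isBarycentric_path_iff hN hη]
  simp only [Function.leftInverse_invFun (pathVertex_injective hη l ρ.symm) _]
  refine ⟨?_, ?_, ?_⟩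
  · intro j
    have a0 := hx (ρ 0)
    have a2 := hx (ρ 2)
    fin_cases j <;> simp [hu] <;> linarith
  · simp [hu, Fin.sum_univ_four]
  · intro i
    obtain ⟨k, rfl⟩ := ρ.surjective i
    rw [← ht, Equiv.symm_apply_apply]
    fin_cases k <;> simp [hu, Fin.sum_univ_four]

theorem hull_subset_closure_bondVolume {N : ℕ} (hN : 0 < N) {η : LPt} (hη : ∀ i, η i ≠ 0)
    {l : LPt} {T : Finset LPt} (hT : T ∈ typeA l η) : hull N T ⊆ closure (bondVolume N η l) := by
  obtain ⟨σ, -, rfl⟩ := Finset.mem_image.1 hT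
  refine convexHull_min ?_ (convex_closure_bondVolume N η l)
  rintro _ ⟨p, hp, rfl⟩
  obtain ⟨j, -, rfl⟩ := Finset.mem_image.1 (Finset.mem_coe.1 hp)
  rw [mem_closure_bondVolume_iff hN hη]
  intro i
  have h2 : (η i : ℝ) ≠ 0 := by exact_mod_cast hη i
  have h3 := (spacing_pos hN).ne'
  have : relCoord N η l (latticePt N (pathVertex l η σ j)) i =
      if (σ i : ℕ) < j then 1 else 0 := by
    simp only [relCoord, latticePt, pathVertex]
    split_ifs <;> push_cast <;> field_simp <;> ring
  rw [this]
  split_ifs <;> norm_num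

theorem one_ne_zero_apply (i : Fin 3) : (1 : LPt) i ≠ 0 := one_ne_zero

/-- Interpolate the function that is nonzero only at a vertex `p` of `S`. From `S` its value at `x`
is nonzero because the weight is positive; from `T` it would vanish if `p` were not a vertex of `T`.
Hence `S ⊆ T`, and the cardinalities agree. -/
theorem eq_of_lattice_tets {N : ℕ} (hN : 0 < N) {l l' : LPt} {S T : Finset LPt}
    (hS : S ∈ typeA l 1) (hT : T ∈ typeA l' 1) {w : LPt → ℝ} {x : Pt} (hw : IsBarycentric N S w x)
    (hpos : ∀ p ∈ S, 0 < w p) (hx : x ∈ hull N T) : S = T := by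
  classical
  obtain ⟨w', hw'⟩ := (mem_hull_iff hN).1 hx
  have hag := agree_typeA hN one_ne_zero_apply l (l' - l)
  rw [one_mul, add_sub_cancel] at hag
  have hcard : T.card = S.card :=
    (typeA_isTetrahedron hN one_ne_zero_apply hT).1.trans
      (typeA_isTetrahedron hN one_ne_zero_apply hS).1.symm
  refine Finset.eq_of_subset_of_card_le (fun p hp => ?_) hcard.le
  by_contra hpT
  have h := hag S hS T hT w w' x hw hw' (Pi.single p 1)
  rw [Finset.sum_eq_single p (fun q _ hq => by rw [Pi.single_eq_of_ne hq, smul_zero])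
    (fun h => absurd hp h), Finset.sum_eq_zero (s := T) (fun q hq => by
      rw [Pi.single_eq_of_ne (by rintro rfl; exact hpT hq), smul_zero]), Pi.single_eq_same] at h
  have := congrFun h 0
  simp at this
  exact (hpos p hp).ne' this

theorem exists_lattice_tet_mem_hull {N : ℕ} (hN : 0 < N) {η : LPt} (hη : ∀ i, η i ≠ 0) {l : LPt}
    {x : Pt} (hx : x ∈ closure (bondVolume N η l)) :
    ∃ T ∈ latticeTets N (bondVolume N η l), x ∈ hull N T := by
  have hε := spacing_pos hN
  have hx' := hx
  rw [closure_bondVolume hN hη, mem_univ_pi] at hx'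
  have hcell : ∀ i, ∃ m : ℤ, min (l i) (l i + η i) ≤ m ∧ m + 1 ≤ max (l i) (l i + η i) ∧
      (m : ℝ) ≤ x i / spacing N ∧ x i / spacing N ≤ m + 1 := by
    intro i
    have hxi := hx' i
    have hlat : ∀ p : LPt, latticePt N p i = spacing N * (p i : ℝ) := fun p => rfl
    have h1 : ((min (l i) (l i + η i) : ℤ) : ℝ) ≤ x i / spacing N := by
      rw [le_div_iff₀ hε, Int.cast_min, min_mul_of_nonneg _ _ hε.le]
      simpa [hlat, mul_comm] using hxi.1
    have h2 : x i / spacing N ≤ ((max (l i) (l i + η i) : ℤ) : ℝ) := by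
      rw [div_le_iff₀ hε, Int.cast_max, max_mul_of_nonneg _ _ hε.le]
      simpa [hlat, mul_comm] using hxi.2
    have h3 : min (l i) (l i + η i) < max (l i) (l i + η i) := by
      have := hη i
      rw [min_lt_max]
      omega
    set z := x i / spacing N
    set A := min (l i) (l i + η i)
    set B := max (l i) (l i + η i)
    have hA : A ≤ ⌊z⌋ := Int.le_floor.2 h1
    -- On the upper face of the box the floor is already `B`, and the last cell, starting at `B -
    -- 1`, is used instead.
    rcases le_or_gt (⌊z⌋ + 1) B with h | h
    · exact ⟨⌊z⌋, hA, h, Int.floor_le z, (Int.lt_floor_add_one z).le⟩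
    · refine ⟨B - 1, by omega, by omega, ?_, by push_cast; linarith⟩
      refine le_trans ?_ (Int.floor_le z)
      exact_mod_cast (by omega : B - 1 ≤ ⌊z⌋)
  choose m hm1 hm2 hm3 hm4 using hcell
  have hxm : x ∈ closure (bondVolume N 1 m) := by
    rw [mem_closure_bondVolume_iff hN one_ne_zero_apply]
    intro i
    have := hm3 i
    have := hm4 i
    simp only [relCoord, Pi.one_apply, Int.cast_one, div_one]
    constructor <;> linarith
  obtain ⟨T, hT, hxT⟩ := exists_typeA_mem_hull hN one_ne_zero_apply hxm
  refine ⟨T, ⟨⟨m, hT⟩, (hull_subset_closure_bondVolume hN one_ne_zero_apply hT).trans ?_⟩, hxT⟩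
  rw [closure_bondVolume hN hη, closure_bondVolume hN one_ne_zero_apply]
  refine Set.pi_mono fun i _ => Icc_subset_Icc ?_ ?_
  · have : ((min (l i) (l i + η i) : ℤ) : ℝ) ≤ m i := by exact_mod_cast hm1 i
    refine le_trans ?_ (le_min (le_of_eq rfl) (by rw [latticePt_add]; simp [hε.le]))
    simp only [latticePt, Pi.add_apply]
    rw [← mul_min_of_nonneg _ _ hε.le]
    push_cast at this ⊢
    gcongr
  · have : ((m i : ℤ) : ℝ) + 1 ≤ ((max (l i) (l i + η i) : ℤ) : ℝ) := by exact_mod_cast hm2 i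
    refine (max_le (by rw [latticePt_add]; simp [hε.le]) (le_of_eq rfl)).trans ?_
    simp only [latticePt, Pi.add_apply, Pi.one_apply]
    rw [← mul_max_of_nonneg _ _ hε.le]
    push_cast at this ⊢
    gcongr

/-- The main diagonal is an edge of every type A tetrahedron, so a step `s • toVec η` moves the
weight `s / spacing N` from its start to its end. In the open box both end weights are positive,
being one minus the largest relative coordinate and the smallest one; a small step therefore stays
in the same tetrahedron, even from a common face. -/
theorem interpolant_typeA_add_smul {N : ℕ} (hN : 0 < N) {η : LPt} (hη : ∀ i, η i ≠ 0) {l : LPt}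
    {x : Pt} (hx : x ∈ bondVolume N η l) (y : Pt → Pt) :
    ∀ᶠ s : ℝ in 𝓝 0, interpolant N (typeA l η) y (x + s • toVec η) =
      interpolant N (typeA l η) y x + s • diffQuot N η y l := by
  have hε := spacing_pos hN
  obtain ⟨T, hT, hxT⟩ := exists_typeA_mem_hull hN hη (subset_closure hx)
  obtain ⟨w, hw⟩ := (mem_hull_iff hN).1 hxT
  have hag := agree_typeA_self hN hη l
  obtain ⟨σ, -, rfl⟩ := Finset.mem_image.1 hT
  rw [mem_bondVolume_iff hN hη] at hx
  have hw' := (isBarycentric_path_iff hN hη).1 hw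
  obtain ⟨h0, h1, hrel⟩ := hw'
  have hpos0 : 0 < w (pathVertex l η σ 0) := by
    have h2 := (hx (σ.symm 0)).2
    have h3 := hrel (σ.symm 0)
    simp [Fin.sum_univ_four] at h3 h1
    linarith
  have hpos3 : 0 < w (pathVertex l η σ 3) := by
    have h2 := (hx (σ.symm 2)).1
    have h3 := hrel (σ.symm 2)
    simp [Fin.sum_univ_four] at h3
    linarith
  have hinj := pathVertex_injective hη l σ
  have e0 : pathVertex l η σ 0 = l := by ext i; simp [pathVertex]
  have e3 : pathVertex l η σ 3 = l + η := by
    ext i; simp [pathVertex]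
  have hev : ∀ᶠ s : ℝ in 𝓝 0, 0 < w (pathVertex l η σ 0) - s / spacing N ∧
      0 < w (pathVertex l η σ 3) + s / spacing N := by
    have c0 : Continuous fun s : ℝ => w (pathVertex l η σ 0) - s / spacing N := by fun_prop
    have c3 : Continuous fun s : ℝ => w (pathVertex l η σ 3) + s / spacing N := by fun_prop
    exact (c0.continuousAt.eventually (lt_mem_nhds (by simpa using hpos0))).and
      (c3.continuousAt.eventually (lt_mem_nhds (by simpa using hpos3)))
  filter_upwards [hev] with s hs
  set c : Fin 4 → ℝ := ![-(s / spacing N), 0, 0, s / spacing N] with hc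
  set w₂ : LPt → ℝ := fun p => w p + c (Function.invFun (pathVertex l η σ) p) with hw₂
  have hw₂v : ∀ j, w₂ (pathVertex l η σ j) = w (pathVertex l η σ j) + c j := fun j => by
    simp only [hw₂, Function.leftInverse_invFun hinj _]
  have hbary : IsBarycentric N (Finset.univ.image (pathVertex l η σ)) w₂ (x + s • toVec η) := by
    rw [isBarycentric_path_iff hN hη]
    simp only [hw₂v]
    refine ⟨?_, ?_, ?_⟩
    · intro j
      have a1 := h0 1
      have a2 := h0 2
      fin_cases j
      · simpa [hc, sub_eq_add_neg] using hs.1.le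
      · simpa [hc] using a1
      · simpa [hc] using a2
      · simpa [hc] using hs.2.le
    · rw [Finset.sum_add_distrib, h1]
      simp [hc, Fin.sum_univ_four]
    · intro i
      have hshift : relCoord N η l (x + s • toVec η) i = relCoord N η l x i + s / spacing N := by
        have h2 : (η i : ℝ) ≠ 0 := by exact_mod_cast hη i
        simp only [relCoord, Pi.add_apply, Pi.smul_apply, toVec, smul_eq_mul]
        field_simp
        ring
      rw [hshift, hrel i]
      generalize σ i = k
      fin_cases k <;> simp [hc, Fin.sum_univ_four] <;> ring
  rw [interpolant_eq hag hT hw, interpolant_eq hag hT hbary, sum_pathVertex hη, sum_pathVertex hη]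
  simp only [hw₂v, Fin.sum_univ_four, e0, e3, diffQuot]
  simp [hc]
  module

/-! ### Gluing the local interpolants -/

/-- The data of the coupled problem. -/
structure IsCoupledProblem (N k : ℕ) (M : Fin 3 → ℕ) (R : Finset LPt) (Ωa Ωs : Set Pt)
    (dec : LPt → LPt → Finset (Finset LPt)) (𝒯c : Finset (Finset LPt)) (v : Pt → Pt) : Prop where
  pos : 0 < N
  bond : ∀ η ∈ R, ∀ i, η i ≠ 0
  splitting : IsSplitting N M R Ωa Ωs
  interfaceDec : IsInterfaceDecomposition N M R Ωa Ωs dec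
  mesh : IsContinuumMesh N Ωa Ωs 𝒯c
  mem : MemCoupledSpace N k M Ωa Ωs 𝒯c v

open Classical in
/-- The decomposition of a bond volume that meets the atomistic region. -/
def localMesh (N : ℕ) (Ωa : Set Pt) (dec : LPt → LPt → Finset (Finset LPt)) (η l : LPt) :
    Finset (Finset LPt) :=
  if InAtomistic N Ωa η l then typeA l η else dec η l

open Classical in
/-- The interpolant of `v` on the bond volumes of classes (a) and (c), and `v` itself on the bond
volumes of class (b). -/
def localField (N : ℕ) (M : Fin 3 → ℕ) (Ωa Ωs : Set Pt) (dec : LPt → LPt → Finset (Finset LPt))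
    (v : Pt → Pt) (η l : LPt) (x : Pt) : Pt :=
  if ¬ InAtomistic N Ωa η l ∧ InContinuum N M Ωs η l then v x
  else interpolant N (localMesh N Ωa dec η l) v x

/-- The index, congruent to `r` modulo `η`, of a bond volume whose closure contains `x`. -/
def cellIndex (N : ℕ) (η r : LPt) (x : Pt) : LPt := r + η * fun i => ⌊relCoord N η r x i⌋

open Classical in
/-- The local fields of all bond volumes congruent to `r` modulo `η`, glued on the atomistic
region, and `v` on the continuum region. -/
def gluedField (N : ℕ) (M : Fin 3 → ℕ) (Ωa Ωs : Set Pt) (dec : LPt → LPt → Finset (Finset LPt))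
    (v : Pt → Pt) (η r : LPt) (x : Pt) : Pt :=
  if x ∈ closure Ωa then localField N M Ωa Ωs dec v η (cellIndex N η r x) x else v x

theorem mem_closure_cellIndex {N : ℕ} (hN : 0 < N) {η : LPt} (hη : ∀ i, η i ≠ 0) (r : LPt)
    (x : Pt) : x ∈ closure (bondVolume N η (cellIndex N η r x)) := by
  rw [mem_closure_bondVolume_iff hN hη]
  intro i
  unfold cellIndex
  rw [relCoord_add_mul hη]
  exact ⟨sub_nonneg.2 (Int.floor_le _), by linarith [Int.lt_floor_add_one (relCoord N η r x i)]⟩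

theorem IsLatticeRegion.isOpen {N : ℕ} {M : Fin 3 → ℕ} {U : Set Pt} (h : IsLatticeRegion N M U) :
    IsOpen U := by
  obtain ⟨⟨𝒮, -, rfl⟩, -⟩ := h
  exact isOpen_interior

theorem IsLatticeRegion.interior_closure {N : ℕ} {M : Fin 3 → ℕ} {U : Set Pt}
    (h : IsLatticeRegion N M U) : interior (closure U) = U := by
  obtain ⟨⟨𝒮, -, rfl⟩, -⟩ := h
  exact interior_closure_idem

theorem domain_eq_Icc (M : Fin 3 → ℕ) :
    domain M = Icc (fun i => -(M i : ℝ) + 1) (fun i => (M i : ℝ)) := by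
  ext x
  simp [domain, Pi.le_def, forall_and]

theorem mem_latticePeriod {N : ℕ} (hN : 0 < N) {M : Fin 3 → ℕ} {l : LPt}
    (h : latticePt N l ∈ domain M) : l ∈ latticePeriod N M := by
  have hN' : (0 : ℝ) < N := by exact_mod_cast hN
  rw [latticePeriod, Fintype.mem_piFinset]
  intro i
  rw [Finset.mem_Icc]
  obtain ⟨h1, h2⟩ := h i
  simp only [latticePt, spacing] at h1 h2
  constructor
  · have : (N : ℝ) * (-(M i : ℝ) + 1) ≤ l i := by
      calc (N : ℝ) * (-(M i : ℝ) + 1) ≤ N * (1 / N * l i) := by gcongr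
        _ = l i := by field_simp
    exact_mod_cast this
  · have : (l i : ℝ) ≤ N * M i := by
      calc (l i : ℝ) = N * (1 / N * l i) := by field_simp
        _ ≤ N * M i := by gcongr
    exact_mod_cast this

theorem latticePt_mem_closure_bondVolume {N : ℕ} (hN : 0 < N) {η : LPt} (hη : ∀ i, η i ≠ 0)
    (l : LPt) : latticePt N l ∈ closure (bondVolume N η l) := by
  rw [closure_bondVolume hN hη]
  exact fun i _ => ⟨min_le_left _ _, le_max_left _ _⟩

theorem mem_closure_of_finite_cover {X ι : Type*} [TopologicalSpace X] {A : Set X} {x : X}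
    (hx : x ∈ closure A) {I : Set ι} (hI : I.Finite) {K : ι → Set X}
    (hcov : A ⊆ ⋃ i ∈ I, K i) : ∃ i ∈ I, x ∈ closure (K i ∩ A) := by
  have hA : A ⊆ ⋃ i ∈ I, K i ∩ A := fun y hy => by
    have := hcov hy
    simp only [mem_iUnion] at this ⊢
    obtain ⟨i, hi, hyi⟩ := this
    exact ⟨i, hi, hyi, hy⟩
  have := closure_mono hA hx
  rw [hI.closure_biUnion] at this
  simpa only [mem_iUnion, exists_prop] using this

namespace IsCoupledProblem

variable {N k : ℕ} {M : Fin 3 → ℕ} {R : Finset LPt} {Ωa Ωs : Set Pt}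
  {dec : LPt → LPt → Finset (Finset LPt)} {𝒯c : Finset (Finset LPt)} {v : Pt → Pt}

theorem isOpen_a (h : IsCoupledProblem N k M R Ωa Ωs dec 𝒯c v) : IsOpen Ωa :=
  h.splitting.region_a.isOpen

theorem isOpen_s (h : IsCoupledProblem N k M R Ωa Ωs dec 𝒯c v) : IsOpen Ωs :=
  h.splitting.region_s.isOpen

theorem notMem_closure_s (h : IsCoupledProblem N k M R Ωa Ωs dec 𝒯c v) {x : Pt} (hx : x ∈ Ωa) :
    x ∉ closure Ωs :=
  Set.disjoint_left.1 (h.splitting.disjoint.closure_right h.isOpen_a) hx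

theorem notMem_closure_a (h : IsCoupledProblem N k M R Ωa Ωs dec 𝒯c v) {x : Pt} (hx : x ∈ Ωs) :
    x ∉ closure Ωa :=
  Set.disjoint_left.1 (h.splitting.disjoint.symm.closure_right h.isOpen_s) hx

theorem closure_bondVolume_subset (h : IsCoupledProblem N k M R Ωa Ωs dec 𝒯c v) {η : LPt}
    (hη : η ∈ R) {l : LPt} {x : Pt} (hx : x ∈ closure (bondVolume N η l))
    (hxa : x ∈ closure Ωa) : closure (bondVolume N η l) ⊆ interior (domain M) :=
  h.splitting.distance η hη l ⟨x, hx, hxa⟩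

/-- The distance condition keeps bond volumes that touch the closed atomistic region inside `Ω`,
which excludes the periodic alternative in `InContinuum`. -/
theorem mem_closure_s_of_inContinuum (h : IsCoupledProblem N k M R Ωa Ωs dec 𝒯c v) {η : LPt}
    (hη : η ∈ R) {l : LPt} {x : Pt} (hx : x ∈ closure (bondVolume N η l))
    (hxa : x ∈ closure Ωa) (hb : InContinuum N M Ωs η l) :
    bondVolume N η l ⊆ Ωs ∧ x ∈ closure Ωs := by
  have hsub : bondVolume N η l ⊆ Ωs := hb.resolve_right fun hn =>
    hn ((subset_closure.trans (h.closure_bondVolume_subset hη hx hxa)).trans interior_subset)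
  exact ⟨hsub, closure_mono hsub hx⟩

theorem exists_mesh_mem_hull (h : IsCoupledProblem N k M R Ωa Ωs dec 𝒯c v) {x : Pt}
    (hx : x ∈ closure Ωs) : ∃ T ∈ 𝒯c, x ∈ hull N T := by
  rw [← h.mesh.decomposition.cover] at hx
  simpa only [mem_iUnion, exists_prop] using hx

/-- The lattice tetrahedra of `Ω_*` touching the interface are elements of the mesh. -/
theorem mem_mesh (h : IsCoupledProblem N k M R Ωa Ωs dec 𝒯c v) {T : Finset LPt}
    (hT : T ∈ latticeTets N Ωs) {x : Pt} (hxT : x ∈ hull N T) (hx : x ∈ interface Ωa Ωs) :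
    T ∈ 𝒯c := by
  obtain ⟨⟨l, hTl⟩, hsub⟩ := hT
  obtain ⟨w, hw⟩ := (mem_hull_iff h.pos).1 hxT
  have hcard : T.card = 4 := (typeA_isTetrahedron h.pos one_ne_zero_apply hTl).1
  set P : Set Pt := {y | ∃ u, IsBarycentric N T u y ∧ ∀ p ∈ T, 0 < u p} with hP
  set c : Pt := ∑ p ∈ T, (1 / 4 : ℝ) • latticePt N p with hc
  have hPx : x ∈ closure P := by
    have hcont : Continuous fun δ : ℝ => (1 - δ) • x + δ • c := by fun_prop
    have htend : Tendsto (fun δ : ℝ => (1 - δ) • x + δ • c) (𝓝[>] 0) (𝓝 x) := by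
      have := hcont.tendsto 0
      simp only [sub_zero, one_smul, zero_smul, add_zero] at this
      exact this.mono_left nhdsWithin_le_nhds
    refine mem_closure_of_tendsto htend ?_
    filter_upwards [Ioo_mem_nhdsGT (zero_lt_one (α := ℝ))] with δ hδ
    have hpos : ∀ p ∈ T, 0 < (1 - δ) * w p + δ * (1 / 4) := fun p hp => by
      have h1 := hw.1 p hp
      have h2 : 0 ≤ (1 - δ) * w p := mul_nonneg (by linarith [hδ.2]) h1
      linarith [hδ.1]
    refine ⟨fun p => (1 - δ) * w p + δ * (1 / 4), ⟨fun p hp => (hpos p hp).le, ?_, ?_⟩, hpos⟩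
    · rw [Finset.sum_add_distrib, ← Finset.mul_sum, hw.2.1, Finset.sum_const, hcard, nsmul_eq_mul]
      push_cast
      ring
    · simp only [add_smul, mul_smul, Finset.sum_add_distrib]
      rw [← Finset.smul_sum, ← Finset.smul_sum, hw.2.2]
  have hPcov : P ⊆ ⋃ T' ∈ (𝒯c : Set (Finset LPt)), hull N T' := by
    rintro y ⟨u, hu, -⟩
    obtain ⟨T', hT', hy⟩ := h.exists_mesh_mem_hull (hsub ((mem_hull_iff h.pos).2 ⟨u, hu⟩))
    simp only [mem_iUnion, exists_prop]
    exact ⟨T', hT', hy⟩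
  -- Some mesh element contains points of `T` with positive weights arbitrarily close to `x`. It is
  -- closed, so it contains `x`, touches the interface and is a lattice tetrahedron; sharing a point
  -- with positive weights, it equals `T`.
  obtain ⟨T', hT', hxT'⟩ := mem_closure_of_finite_cover hPx (Finset.finite_toSet _) hPcov
  have hxT'' : x ∈ hull N T' :=
    (isClosed_hull N T').closure_subset_iff.2 inter_subset_left hxT'
  obtain ⟨y, hyT', u, hu, hupos⟩ := closure_nonempty_iff.1 ⟨x, hxT'⟩
  obtain ⟨⟨l', hT'l⟩, -⟩ := h.mesh.lattice_at_interface T' hT' ⟨x, hxT'', hx⟩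
  rwa [eq_of_lattice_tets h.pos hTl hT'l hu hupos hyT']

/-- Mesh elements that touch the interface carry affine functions, and by `mem_mesh` the lattice
tetrahedron `T` is one of them. This is what matches `v` to the lattice interpolants. -/
theorem eq_sum_of_mem_interface (h : IsCoupledProblem N k M R Ωa Ωs dec 𝒯c v) {T : Finset LPt}
    (hT : T ∈ latticeTets N Ωs) {w : LPt → ℝ} {x : Pt} (hw : IsBarycentric N T w x)
    (hx : x ∈ interface Ωa Ωs) : v x = ∑ p ∈ T, w p • v (latticePt N p) := by
  have hxT : x ∈ hull N T := (mem_hull_iff h.pos).2 ⟨w, hw⟩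
  have hpoly := h.mem.continuum.linear T (h.mem_mesh hT hxT hx) ⟨x, hxT, hx⟩
  have := hpoly.sum_smul T w hw.2.1 (latticePt N) (fun p hp => latticePt_mem_hull hp)
    (by rw [hw.2.2]; exact hxT)
  rwa [hw.2.2] at this

theorem localMesh_isTetrahedron (h : IsCoupledProblem N k M R Ωa Ωs dec 𝒯c v) {η : LPt}
    (hη : η ∈ R) {l : LPt} (hl : ¬ (¬ InAtomistic N Ωa η l ∧ InContinuum N M Ωs η l)) :
    ∀ T ∈ localMesh N Ωa dec η l, IsTetrahedron N T := by
  intro T hT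
  unfold localMesh at hT
  split_ifs at hT with ha
  · exact typeA_isTetrahedron h.pos (h.bond η hη) hT
  · exact (h.interfaceDec.decomposition η hη l ⟨ha, fun hb => hl ⟨ha, hb⟩⟩).tetrahedron T hT

theorem localMesh_agree (h : IsCoupledProblem N k M R Ωa Ωs dec 𝒯c v) {η : LPt}
    (hη : η ∈ R) {l : LPt} (hl : ¬ (¬ InAtomistic N Ωa η l ∧ InContinuum N M Ωs η l)) :
    Agree N (localMesh N Ωa dec η l) (localMesh N Ωa dec η l) := by
  by_cases ha : InAtomistic N Ωa η l
  · rw [localMesh, if_pos ha]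
    exact agree_typeA_self h.pos (h.bond η hη) l
  · have hd := h.interfaceDec.decomposition η hη l ⟨ha, fun hb => hl ⟨ha, hb⟩⟩
    rw [localMesh, if_neg ha]
    exact hd.conforming.agree h.pos hd.tetrahedron hd.tetrahedron

theorem exists_localMesh (h : IsCoupledProblem N k M R Ωa Ωs dec 𝒯c v) {η : LPt}
    (hη : η ∈ R) {l : LPt} (hl : ¬ (¬ InAtomistic N Ωa η l ∧ InContinuum N M Ωs η l)) {x : Pt}
    (hx : x ∈ closure (bondVolume N η l)) : ∃ T ∈ localMesh N Ωa dec η l, x ∈ hull N T := by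
  by_cases ha : InAtomistic N Ωa η l
  · rw [localMesh, if_pos ha]
    exact exists_typeA_mem_hull h.pos (h.bond η hη) hx
  · have hd := h.interfaceDec.decomposition η hη l ⟨ha, fun hb => hl ⟨ha, hb⟩⟩
    rw [localMesh, if_neg ha]
    rw [← hd.cover] at hx
    simpa only [mem_iUnion, exists_prop] using hx

theorem hull_subset_of_mem_localMesh (h : IsCoupledProblem N k M R Ωa Ωs dec 𝒯c v) {η : LPt}
    (hη : η ∈ R) {l : LPt} (hl : ¬ (¬ InAtomistic N Ωa η l ∧ InContinuum N M Ωs η l))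
    {T : Finset LPt} (hT : T ∈ localMesh N Ωa dec η l) :
    hull N T ⊆ closure (bondVolume N η l) := by
  unfold localMesh at hT
  split_ifs at hT with ha
  · exact hull_subset_closure_bondVolume h.pos (h.bond η hη) hT
  · rw [← (h.interfaceDec.decomposition η hη l ⟨ha, fun hb => hl ⟨ha, hb⟩⟩).cover]
    exact fun x hx => mem_biUnion hT hx

theorem localField_eq_sum (h : IsCoupledProblem N k M R Ωa Ωs dec 𝒯c v) {η : LPt}
    (hη : η ∈ R) {l : LPt} (hl : ¬ (¬ InAtomistic N Ωa η l ∧ InContinuum N M Ωs η l))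
    {T : Finset LPt} (hT : T ∈ localMesh N Ωa dec η l) {w : LPt → ℝ} {x : Pt}
    (hw : IsBarycentric N T w x) :
    localField N M Ωa Ωs dec v η l x = ∑ p ∈ T, w p • v (latticePt N p) := by
  rw [localField, if_neg hl, interpolant_eq (h.localMesh_agree hη hl) hT hw]

theorem localField_eq_of_agree (h : IsCoupledProblem N k M R Ωa Ωs dec 𝒯c v) {η : LPt}
    (hη : η ∈ R) {l l' : LPt} (hl : ¬ (¬ InAtomistic N Ωa η l ∧ InContinuum N M Ωs η l))
    (hl' : ¬ (¬ InAtomistic N Ωa η l' ∧ InContinuum N M Ωs η l'))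
    (hag : Agree N (localMesh N Ωa dec η l) (localMesh N Ωa dec η l')) {x : Pt}
    (hx : x ∈ closure (bondVolume N η l)) (hx' : x ∈ closure (bondVolume N η l')) :
    localField N M Ωa Ωs dec v η l x = localField N M Ωa Ωs dec v η l' x := by
  obtain ⟨S, hS, hxS⟩ := h.exists_localMesh hη hl hx
  obtain ⟨T, hT, hxT⟩ := h.exists_localMesh hη hl' hx'
  obtain ⟨w, hw⟩ := (mem_hull_iff h.pos).1 hxS
  obtain ⟨w', hw'⟩ := (mem_hull_iff h.pos).1 hxT
  rw [h.localField_eq_sum hη hl hS hw, h.localField_eq_sum hη hl' hT hw']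
  exact hag S hS T hT w w' x hw hw' _

/-- If the neighbour is of class (b), its field is `v`, while compatibility concerns its lattice
tetrahedra. The common point is then on the interface, where `v` is the interpolation on such a
tetrahedron. For the other classes both fields are interpolants and conformity suffices. -/
theorem localField_eq_of_conforming (h : IsCoupledProblem N k M R Ωa Ωs dec 𝒯c v) {η : LPt}
    (hη : η ∈ R) {l l' : LPt} (hl : AtInterface N M Ωa Ωs η l)
    (hc : Conforming N (dec η l) (bondMesh N M Ωa Ωs dec η l')) {x : Pt}
    (hx : x ∈ closure (bondVolume N η l)) (hx' : x ∈ closure (bondVolume N η l'))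
    (hxa : x ∈ closure Ωa) :
    localField N M Ωa Ωs dec v η l x = localField N M Ωa Ωs dec v η l' x := by
  have hlm : localMesh N Ωa dec η l = dec η l := by rw [localMesh, if_neg hl.1]
  have hl₂ : ¬ (¬ InAtomistic N Ωa η l ∧ InContinuum N M Ωs η l) := fun hn => hl.2 hn.2
  have htet := h.localMesh_isTetrahedron hη hl₂
  by_cases hl' : ¬ InAtomistic N Ωa η l' ∧ InContinuum N M Ωs η l'
  · obtain ⟨hsub, hxs⟩ := h.mem_closure_s_of_inContinuum hη hx' hxa hl'.2
    rw [bondMesh, if_neg hl'.1, if_pos hl'.2] at hc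
    obtain ⟨T, hT, hxT⟩ := exists_lattice_tet_mem_hull h.pos (h.bond η hη) hx'
    obtain ⟨S, hS, hxS⟩ := h.exists_localMesh hη hl₂ hx
    obtain ⟨w, hw⟩ := (mem_hull_iff h.pos).1 hxS
    obtain ⟨w', hw'⟩ := (mem_hull_iff h.pos).1 hxT
    have hag := hc.agree h.pos (by rw [← hlm]; exact htet)
      fun T hT => let ⟨⟨_, hT₁⟩, _⟩ := hT; typeA_isTetrahedron h.pos one_ne_zero_apply hT₁
    rw [h.localField_eq_sum hη hl₂ hS hw, localField, if_pos hl',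
      h.eq_sum_of_mem_interface ⟨hT.1, hT.2.trans (closure_mono hsub)⟩ hw' ⟨hxa, hxs⟩]
    rw [hlm] at hS
    exact hag S hS T hT w w' x hw hw' _
  · refine h.localField_eq_of_agree hη hl₂ hl' ?_ hx hx'
    have hb : bondMesh N M Ωa Ωs dec η l' = localMesh N Ωa dec η l' := by
      unfold bondMesh localMesh
      by_cases ha : InAtomistic N Ωa η l'
      · simp [ha]
      · have : ¬ InContinuum N M Ωs η l' := fun hb => hl' ⟨ha, hb⟩
        simp [ha, this]
    rw [hb] at hc
    refine Conforming.agree h.pos ?_ htet (h.localMesh_isTetrahedron hη hl')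
    rw [hlm]
    exact hc

/-- Compatibility settles the case of an interface bond volume on either side, `agree_typeA` that of
two volumes of class (a); two of class (b) both carry `v`. Class (a) cannot meet class (b) at `x`,
as the open atomistic region misses the closure of the continuum region. -/
theorem localField_eq_of_face (h : IsCoupledProblem N k M R Ωa Ωs dec 𝒯c v) {η : LPt}
    (hη : η ∈ R) {l : LPt} (i : Fin 3) {x : Pt} (hx : x ∈ closure (bondVolume N η l))
    (hx' : x ∈ closure (bondVolume N η (l + Pi.single i (η i)))) (hxa : x ∈ closure Ωa) :
    localField N M Ωa Ωs dec v η l x =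
      localField N M Ωa Ωs dec v η (l + Pi.single i (η i)) x := by
  set l' := l + Pi.single i (η i) with hl'
  by_cases hc : AtInterface N M Ωa Ωs η l
  · exact h.localField_eq_of_conforming hη hc (h.interfaceDec.compatible η hη l hc i).1 hx hx' hxa
  by_cases hc' : AtInterface N M Ωa Ωs η l'
  · have := (h.interfaceDec.compatible η hη l' hc' i).2
    rw [show l' - Pi.single i (η i) = l by rw [hl', add_sub_cancel_right]] at this
    exact (h.localField_eq_of_conforming hη hc' this hx' hx hxa).symm
  have not_mixed : ∀ m m', InAtomistic N Ωa η m → InContinuum N M Ωs η m' →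
      x ∈ closure (bondVolume N η m) → x ∈ closure (bondVolume N η m') → False :=
    fun m m' ha hb hm hm' =>
      h.notMem_closure_s (ha hm) (h.mem_closure_s_of_inContinuum hη hm' hxa hb).2
  have hcls : ∀ m, ¬ AtInterface N M Ωa Ωs η m → InAtomistic N Ωa η m ∨ InContinuum N M Ωs η m :=
    fun m hm => by
      by_contra hn
      rw [not_or] at hn
      exact hm hn
  rcases hcls l hc with ha | hb
  · have ha' : InAtomistic N Ωa η l' :=
      (hcls l' hc').resolve_right fun hb' => not_mixed l l' ha hb' hx hx'
    refine h.localField_eq_of_agree hη (fun hn => hn.1 ha) (fun hn => hn.1 ha') ?_ hx hx'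
    rw [localMesh, localMesh, if_pos ha, if_pos ha']
    have : l' = l + η * Pi.single i 1 := by
      rw [hl']
      congr 1
      ext j
      rcases eq_or_ne j i with rfl | hj
      · simp
      · simp [hj]
    rw [this]
    exact agree_typeA h.pos (h.bond η hη) l _
  · have hna : ¬ InAtomistic N Ωa η l := fun ha => not_mixed l l ha hb hx hx
    have hna' : ¬ InAtomistic N Ωa η l' := fun ha => not_mixed l' l ha hb hx' hx
    have hb' := (hcls l' hc').resolve_left hna'
    rw [localField, localField, if_pos ⟨hna, hb⟩, if_pos ⟨hna', hb'⟩]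

theorem localField_add_single (h : IsCoupledProblem N k M R Ωa Ωs dec 𝒯c v) {η : LPt}
    (hη : η ∈ R) {l : LPt} (i : Fin 3) (δ : ℤ) {x : Pt} (hx : x ∈ closure (bondVolume N η l))
    (hx' : x ∈ closure (bondVolume N η (l + η * Pi.single i δ))) (hxa : x ∈ closure Ωa) :
    localField N M Ωa Ωs dec v η (l + η * Pi.single i δ) x =
      localField N M Ωa Ωs dec v η l x := by
  have hb := h.bond η hη
  have h1 := (mem_closure_bondVolume_iff h.pos hb).1 hx i
  have h2 := (mem_closure_bondVolume_iff h.pos hb).1 hx' i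
  rw [relCoord_add_mul hb, Pi.single_eq_same] at h2
  -- Both relative coordinates lie in `[0, 1]` and differ by `δ`, so only equal or adjacent boxes
  -- occur.
  have h3 : (δ : ℝ) ≤ 1 := by linarith
  have h4 : (-1 : ℝ) ≤ δ := by linarith
  have h3' : δ ≤ 1 := by exact_mod_cast h3
  have h4' : -1 ≤ δ := by exact_mod_cast h4
  have hs : ∀ δ : ℤ, η * Pi.single i δ = Pi.single i (η i * δ) := by
    intro δ
    ext j
    rcases eq_or_ne j i with rfl | hj
    · simp
    · simp [hj]
  rw [hs] at hx' ⊢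
  obtain hδ | hδ | hδ : δ = -1 ∨ δ = 0 ∨ δ = 1 := by omega
  · have hl : l + Pi.single i (η i * δ) + Pi.single i (η i) = l := by
      rw [add_assoc, ← Pi.single_add, hδ]
      simp
    generalize l + Pi.single i (η i * δ) = l' at hx' hl ⊢
    subst hl
    exact h.localField_eq_of_face hη i hx' hx hxa
  · rw [hδ]
    simp
  · rw [hδ, mul_one] at hx' ⊢
    exact (h.localField_eq_of_face hη i hx hx' hxa).symm

/-- Boxes sharing only an edge or a vertex are joined by changing one coordinate at a time.
Membership in a closed box is coordinatewise, so the intermediate boxes also contain `x`, and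
compatibility across faces is enough. -/
theorem localField_add_mul (h : IsCoupledProblem N k M R Ωa Ωs dec 𝒯c v) {η : LPt}
    (hη : η ∈ R) {l : LPt} (m : LPt) {x : Pt} (hx : x ∈ closure (bondVolume N η l))
    (hx' : x ∈ closure (bondVolume N η (l + η * m))) (hxa : x ∈ closure Ωa) :
    localField N M Ωa Ωs dec v η (l + η * m) x = localField N M Ωa Ωs dec v η l x := by
  have hb := h.bond η hη
  have hmem : ∀ m' : LPt, (∀ i, m' i = 0 ∨ m' i = m i) →
      x ∈ closure (bondVolume N η (l + η * m')) := by
    intro m' hm'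
    rw [mem_closure_bondVolume_iff h.pos hb] at hx hx' ⊢
    intro i
    have h1 := hx i
    have h2 := hx' i
    rw [relCoord_add_mul hb] at h2 ⊢
    rcases hm' i with h0 | h0 <;> rw [h0]
    · simpa using h1
    · exact h2
  have e1 : l + η * Pi.single 0 (m 0) = l + η * ![m 0, 0, 0] := by
    congr 2; ext i; fin_cases i <;> simp
  have e2 : l + η * ![m 0, 0, 0] + η * Pi.single 1 (m 1) = l + η * ![m 0, m 1, 0] := by
    rw [add_assoc, ← mul_add]; congr 2; ext i; fin_cases i <;> simp
  have e3 : l + η * ![m 0, m 1, 0] + η * Pi.single 2 (m 2) = l + η * m := by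
    rw [add_assoc, ← mul_add]; congr 2; ext i; fin_cases i <;> simp
  have m1 := hmem ![m 0, 0, 0] (by intro i; fin_cases i <;> simp)
  have m2 := hmem ![m 0, m 1, 0] (by intro i; fin_cases i <;> simp)
  have s1 := h.localField_add_single hη 0 (m 0) hx (by rw [e1]; exact m1) hxa
  have s2 := h.localField_add_single hη 1 (m 1) m1 (by rw [e2]; exact m2) hxa
  have s3 := h.localField_add_single hη 2 (m 2) m2 (by rw [e3]; exact hx') hxa
  rw [e1] at s1
  rw [e2] at s2
  rw [e3] at s3
  rw [s3, s2, s1]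

/-- The given box may meet the continuum region nowhere near `x`. By finiteness, some congruent box
containing `x` does have points of `Ωs` accumulating there, and the field may be evaluated in it. If
that box is not of class (b), one of its tetrahedra contains `x` and a point of `Ωs`; it does not
cross the interface, hence is a lattice tetrahedron of `Ωs`, on which `v` is interpolated at `x`. -/
theorem localField_eq_on_interface (h : IsCoupledProblem N k M R Ωa Ωs dec 𝒯c v) {η : LPt}
    (hη : η ∈ R) {l : LPt} {x : Pt} (hx : x ∈ closure (bondVolume N η l))
    (hΓ : x ∈ interface Ωa Ωs) : localField N M Ωa Ωs dec v η l x = v x := by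
  have hb := h.bond η hη
  -- The box enlarged by one box width on each side: a neighbourhood of `x` covered by the 27
  -- congruent boxes with index in `{-1, 0, 1}³`.
  set U : Set Pt := {y | ∀ i, -1 < relCoord N η l y i ∧ relCoord N η l y i < 2} with hU
  have hUopen : IsOpen U := by
    have : U = ⋂ i, {y | -1 < relCoord N η l y i ∧ relCoord N η l y i < 2} := by
      ext y; simp [hU]
    rw [this]
    refine isOpen_iInter_of_finite fun i => ?_
    have hc : Continuous fun y => relCoord N η l y i := by unfold relCoord; fun_prop
    exact (isOpen_lt continuous_const hc).inter (isOpen_lt hc continuous_const)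
  have hxU : x ∈ U := fun i => by
    have := (mem_closure_bondVolume_iff h.pos hb).1 hx i
    constructor <;> linarith
  have hxs : x ∈ closure (U ∩ Ωs) := hUopen.inter_closure ⟨hxU, hΓ.2⟩
  have hcov : U ∩ Ωs ⊆ ⋃ m ∈ (Set.Icc (-1 : LPt) 1), closure (bondVolume N η (l + η * m)) := by
    rintro y ⟨hy, -⟩
    simp only [mem_iUnion, exists_prop]
    refine ⟨fun i => ⌊relCoord N η l y i⌋, ?_, mem_closure_cellIndex h.pos hb l y⟩
    refine ⟨fun i => ?_, fun i => ?_⟩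
    · rw [Pi.neg_apply, Pi.one_apply, Int.le_floor]
      push_cast
      exact (hy i).1.le
    · rw [Pi.one_apply, ← Int.lt_add_one_iff, Int.floor_lt]
      push_cast
      linarith [(hy i).2]
  obtain ⟨m, -, hm⟩ := mem_closure_of_finite_cover hxs (Set.finite_Icc _ _) hcov
  have hxm : x ∈ closure (bondVolume N η (l + η * m)) :=
    isClosed_closure.closure_subset_iff.2 inter_subset_left hm
  rw [← h.localField_add_mul hη m hx hxm hΓ.1]
  set l' := l + η * m
  have hna : ¬ InAtomistic N Ωa η l' := fun ha => h.notMem_closure_s (ha hxm) hΓ.2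
  by_cases hcl : ¬ InAtomistic N Ωa η l' ∧ InContinuum N M Ωs η l'
  · rw [localField, if_pos hcl]
  · have hcov' : closure (bondVolume N η l') ∩ (U ∩ Ωs) ⊆
        ⋃ T ∈ (localMesh N Ωa dec η l' : Set (Finset LPt)), hull N T := by
      rintro y ⟨hy, -⟩
      simp only [mem_iUnion, exists_prop]
      exact h.exists_localMesh hη hcl hy
    obtain ⟨T, hT, hxT⟩ := mem_closure_of_finite_cover hm (Finset.finite_toSet _) hcov'
    have hxT' : x ∈ hull N T :=
      (isClosed_hull N T).closure_subset_iff.2 inter_subset_left hxT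
    obtain ⟨y, hyT, -, -, hys⟩ := closure_nonempty_iff.1 ⟨x, hxT⟩
    have hif : AtInterface N M Ωa Ωs η l' := ⟨hna, fun hn => hcl ⟨hna, hn⟩⟩
    have hTd : T ∈ dec η l' := by
      have hT₂ := Finset.mem_coe.1 hT
      rwa [localMesh, if_neg hna] at hT₂
    have hsub : hull N T ⊆ closure Ωs :=
      (h.interfaceDec.resolves η hη l' hif T hTd).resolve_left fun hn =>
        h.notMem_closure_a hys (hn hyT)
    obtain ⟨w, hw⟩ := (mem_hull_iff h.pos).1 hxT'
    rw [h.localField_eq_sum hη hcl hT hw,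
      h.eq_sum_of_mem_interface (h.interfaceDec.continuum η hη l' hif T hTd hsub) hw hΓ]

theorem gluedField_eq_of_mem_closure_s (h : IsCoupledProblem N k M R Ωa Ωs dec 𝒯c v) {η : LPt}
    (hη : η ∈ R) (r : LPt) {x : Pt} (hx : x ∈ closure Ωs) :
    gluedField N M Ωa Ωs dec v η r x = v x := by
  unfold gluedField
  split_ifs with hxa
  · exact h.localField_eq_on_interface hη (mem_closure_cellIndex h.pos (h.bond η hη) r x) ⟨hxa, hx⟩
  · rfl

theorem gluedField_eq_localField (h : IsCoupledProblem N k M R Ωa Ωs dec 𝒯c v) {η : LPt}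
    (hη : η ∈ R) (r m : LPt) {x : Pt} (hx : x ∈ closure Ωa)
    (hxm : x ∈ closure (bondVolume N η (r + η * m))) :
    gluedField N M Ωa Ωs dec v η r x = localField N M Ωa Ωs dec v η (r + η * m) x := by
  rw [gluedField, if_pos hx]
  have hc := mem_closure_cellIndex h.pos (h.bond η hη) r x
  have he : cellIndex N η r x = r + η * m + η * ((fun i => ⌊relCoord N η r x i⌋) - m) := by
    rw [add_assoc, ← mul_add, add_sub_cancel]
    rfl
  rw [he] at hc ⊢
  exact h.localField_add_mul hη _ hxm hc hx

/-- Finitely many closed pieces cover `Ω`: the mesh elements, where the field is the piecewise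
polynomial `v`, and the atomistic parts of the tetrahedra of the bond volumes, where it is affine.
The two descriptions hold on the whole closed pieces because the field is single-valued across boxes
and on the interface. -/
theorem exists_lipschitzOnWith_gluedField (h : IsCoupledProblem N k M R Ωa Ωs dec 𝒯c v) {η : LPt}
    (hη : η ∈ R) (r : LPt) :
    ∃ C, LipschitzOnWith C (gluedField N M Ωa Ωs dec v η r) (domain M) := by
  have hb := h.bond η hη
  set I : Set LPt := {l | l ∈ latticePeriod N M ∧ (∃ m, l = r + η * m) ∧
    ¬ (¬ InAtomistic N Ωa η l ∧ InContinuum N M Ωs η l)} with hI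
  have hIfin : I.Finite := (latticePeriod N M).finite_toSet.subset fun l hl => hl.1
  refine exists_lipschitzOnWith_of_finite_closed_cover (𝒦 := (hull N '' (𝒯c : Set (Finset LPt))) ∪
    ⋃ l ∈ I, (fun T => hull N T ∩ closure Ωa) '' (localMesh N Ωa dec η l : Set (Finset LPt)))
    (by rw [domain_eq_Icc]; exact convex_Icc _ _)
    ((𝒯c.finite_toSet.image _).union
      (hIfin.biUnion fun l _ => (Finset.finite_toSet _).image _)) ?_ ?_ ?_
  · rintro K (⟨T, -, rfl⟩ | hK)
    · exact isClosed_hull N T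
    · simp only [mem_iUnion] at hK
      obtain ⟨l, -, T, -, rfl⟩ := hK
      exact (isClosed_hull N T).inter isClosed_closure
  · rintro K (⟨T, hT, rfl⟩ | hK)
    · have hsub : hull N T ⊆ closure Ωs := by
        rw [← h.mesh.decomposition.cover]
        exact fun x hx => mem_biUnion hT hx
      have hlip : ∃ C, LipschitzOnWith C v (hull N T) := by
        by_cases hΓ : (hull N T ∩ interface Ωa Ωs).Nonempty
        · exact (h.mem.continuum.linear T hT hΓ).exists_lipschitzOnWith (isCompact_hull N T)
        · exact (h.mem.continuum.poly T hT hΓ).exists_lipschitzOnWith (isCompact_hull N T)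
      obtain ⟨C, hC⟩ := hlip
      refine ⟨C, fun x hx y hy => ?_⟩
      rw [h.gluedField_eq_of_mem_closure_s hη r (hsub hx),
        h.gluedField_eq_of_mem_closure_s hη r (hsub hy)]
      exact hC hx hy
    · simp only [mem_iUnion] at hK
      obtain ⟨l, ⟨-, ⟨m, rfl⟩, hl⟩, T, hT, rfl⟩ := hK
      obtain ⟨A, hA⟩ := (h.localMesh_isTetrahedron hη hl T hT).exists_affineMap
        fun p => v (latticePt N p)
      have hval : ∀ x ∈ hull N T ∩ closure Ωa, gluedField N M Ωa Ωs dec v η r x = A x := by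
        rintro x ⟨hx, hxa⟩
        obtain ⟨w, hw⟩ := (mem_hull_iff h.pos).1 hx
        rw [h.gluedField_eq_localField hη r m hxa (h.hull_subset_of_mem_localMesh hη hl hT hx),
          h.localField_eq_sum hη hl hT hw, ← hw.2.2, AffineMap.map_sum_smul A hw.2.1]
        exact Finset.sum_congr rfl fun p hp => by rw [hA p hp]
      let L : Pt →L[ℝ] Pt := LinearMap.toContinuousLinearMap A.linear
      refine ⟨‖L‖₊, fun x hx y hy => ?_⟩
      rw [hval x hx, hval y hy, edist_eq_enorm_sub, edist_eq_enorm_sub, ← vsub_eq_sub (A x),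
        ← AffineMap.linearMap_vsub]
      exact L.le_opENorm _
  · intro x hx
    by_cases hxs : x ∈ closure Ωs
    · obtain ⟨T, hT, hxT⟩ := h.exists_mesh_mem_hull hxs
      exact ⟨_, Or.inl ⟨T, hT, rfl⟩, hxT⟩
    · have hxa : x ∈ closure Ωa := by
        rw [h.splitting.cover] at hx
        exact hx.resolve_right hxs
      have hc := mem_closure_cellIndex h.pos hb r x
      have hl : ¬ (¬ InAtomistic N Ωa η (cellIndex N η r x) ∧
          InContinuum N M Ωs η (cellIndex N η r x)) := fun hn =>
        hxs (h.mem_closure_s_of_inContinuum hη hc hxa hn.2).2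
      obtain ⟨T, hT, hxT⟩ := h.exists_localMesh hη hl hc
      refine ⟨hull N T ∩ closure Ωa, Or.inr ?_, hxT, hxa⟩
      simp only [mem_iUnion]
      refine ⟨cellIndex N η r x, ⟨?_, ⟨_, rfl⟩, hl⟩, T, hT, rfl⟩
      exact mem_latticePeriod h.pos (interior_subset (h.closure_bondVolume_subset hη hc hxa
        (latticePt_mem_closure_bondVolume h.pos hb _)))

end IsCoupledProblem

/-! ### Integrals over the domain and its subdomains -/

theorem convex_domain (M : Fin 3 → ℕ) : Convex ℝ (domain M) := by
  rw [domain_eq_Icc]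
  exact convex_Icc _ _

theorem isCompact_domain (M : Fin 3 → ℕ) : IsCompact (domain M) := by
  rw [domain_eq_Icc]
  exact isCompact_Icc

theorem ae_norm_fderiv_apply_le {M : Fin 3 → ℕ} {F : Type*} [NormedAddCommGroup F]
    [NormedSpace ℝ F] [FiniteDimensional ℝ F] {w : Pt → F} {C : ℝ≥0}
    (hw : LipschitzOnWith C w (domain M)) (e : Pt) :
    ∀ᵐ x ∂(volume.restrict (domain M)), ‖fderiv ℝ w x e‖ ≤ C * ‖e‖ := by
  rw [ae_restrict_iff' (isCompact_domain M).measurableSet]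
  filter_upwards [ae_differentiableAt_of_lipschitzOnWith_convex (convex_domain M) hw] with x hx hxs
  refine (ContinuousLinearMap.le_opNorm _ _).trans ?_
  gcongr
  exact norm_fderiv_le_of_lipschitzOn ℝ (hx hxs).1 hw

theorem integrableOn_fderiv_apply {M : Fin 3 → ℕ} {F : Type*} [NormedAddCommGroup F]
    [NormedSpace ℝ F] [FiniteDimensional ℝ F] {w : Pt → F} {C : ℝ≥0}
    (hw : LipschitzOnWith C w (domain M)) (e : Pt) :
    IntegrableOn (fun x => fderiv ℝ w x e) (domain M) := by
  borelize F
  exact Measure.integrableOn_of_bounded (isCompact_domain M).measure_lt_top.ne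
    (measurable_fderiv_apply_const ℝ w e).aestronglyMeasurable (ae_norm_fderiv_apply_le hw e)

/-- The mean of the gradient of a periodic Lipschitz function vanishes. -/
theorem integral_fderiv_apply_eq_zero {M : Fin 3 → ℕ} (hM : ∀ i, 0 < M i) {w : Pt → Pt} {C : ℝ≥0}
    (hw : LipschitzOnWith C w (domain M))
    (hper : ∀ i : Fin 3, ∀ x ∈ domain M, x + Pi.single i (2 * (M i : ℝ) - 1) ∈ domain M →
      w (x + Pi.single i (2 * (M i : ℝ) - 1)) = w x) (e : Pt) :
    ∫ x in domain M, fderiv ℝ w x e = 0 := by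
  ext j
  have hwj : LipschitzOnWith (1 * C) (fun x => w x j) (domain M) :=
    (LipschitzWith.eval j).comp_lipschitzOnWith hw
  have hcoord : ∀ i, ∫ x in domain M, fderiv ℝ (fun x => w x j) x (Pi.single i 1) = 0 := by
    intro i
    have hMi : (1 : ℝ) ≤ M i := by exact_mod_cast hM i
    have hle : -(M i : ℝ) + 1 ≤ M i := by linarith
    rw [domain_eq_Icc] at hwj ⊢
    refine integral_fderiv_single_eq_zero i hle hwj fun z hz => ?_
    have hz' := hz
    rw [← domain_eq_Icc] at hz
    have heq : (i.insertNth (M i : ℝ) z : Pt) =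
        i.insertNth (-(M i : ℝ) + 1) z + Pi.single i (2 * (M i : ℝ) - 1) := by
      ext k
      refine Fin.succAboveCases i ?_ (fun k => ?_) k
      · simp; ring
      · simp
    have hmem : (i.insertNth (-(M i : ℝ) + 1) z + Pi.single i (2 * (M i : ℝ) - 1) : Pt) ∈
        domain M := by
      rw [← heq, domain_eq_Icc]
      simp only [mem_Icc, Pi.le_def, Fin.forall_iff_succAbove i,
        Fin.insertNth_apply_same, Fin.insertNth_apply_succAbove] at hz' ⊢
      exact ⟨⟨hle, hz'.1.2⟩, le_rfl, hz'.2.2⟩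
    change w (i.insertNth (M i : ℝ) z) j = _
    rw [heq, hper i _ hz hmem]
  have hint := integrableOn_fderiv_apply hw e
  have h1 : (∫ x in domain M, fderiv ℝ w x e) j = ∫ x in domain M, fderiv ℝ w x e j :=
    ((ContinuousLinearMap.proj (R := ℝ) (φ := fun _ : Fin 3 => ℝ) j).integral_comp_comm hint).symm
  rw [h1, Pi.zero_apply]
  have h2 : ∀ᵐ x ∂(volume.restrict (domain M)), fderiv ℝ w x e j =
      ∑ i, e i * fderiv ℝ (fun x => w x j) x (Pi.single i 1) := by
    rw [ae_restrict_iff' (isCompact_domain M).measurableSet]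
    filter_upwards [ae_differentiableAt_of_lipschitzOnWith_convex (convex_domain M) hw] with x hx hxs
    have hd := (hx hxs).2
    have h3 : fderiv ℝ (fun x => w x j) x =
        (ContinuousLinearMap.proj (R := ℝ) (φ := fun _ : Fin 3 => ℝ) j).comp (fderiv ℝ w x) :=
      ((ContinuousLinearMap.proj (R := ℝ) (φ := fun _ : Fin 3 => ℝ) j).hasFDerivAt.comp x
        hd.hasFDerivAt).fderiv
    have h4 : e = ∑ i, e i • (Pi.single i 1 : Pt) := by
      ext k
      simp [Finset.sum_apply, Pi.single_apply]
    conv_lhs => rw [h4]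
    rw [map_sum, Finset.sum_apply]
    refine Finset.sum_congr rfl fun i _ => ?_
    rw [map_smul, h3]
    rfl
  rw [integral_congr_ae h2, integral_finsetSum _ fun i _ =>
    (integrableOn_fderiv_apply hwj (Pi.single i 1)).const_mul (e i)]
  refine Finset.sum_eq_zero fun i _ => ?_
  rw [integral_const_mul, hcoord, mul_zero]

/-- The derivative of a stored energy at a homogeneous deformation. -/
theorem hasDerivAt_energy {M : Fin 3 → ℕ} {φ : Pt → ℝ} (hφ : ContDiff ℝ 1 φ) {S : Set Pt}
    (hS : IsOpen S) (hSM : S ⊆ domain M) {w : Pt → Pt} {C : ℝ≥0}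
    (hw : LipschitzOnWith C w (domain M)) {g : Pt → Pt} (hg : EqOn g w S)
    (F : Matrix (Fin 3) (Fin 3) ℝ) {y : ℝ → Pt → Pt}
    (hy : ∀ t, EqOn (y t) (fun x => F.mulVec x + t • g x) S) (e : Pt) :
    HasDerivAt (fun t => ∫ x in S, φ (fderiv ℝ (y t) x e))
      (fderiv ℝ φ (F.mulVec e) (∫ x in S, fderiv ℝ g x e)) 0 := by
  have hfin : IsFiniteMeasure (volume.restrict S) :=
    ⟨by rw [Measure.restrict_apply_univ]
        exact (measure_mono hSM).trans_lt (isCompact_domain M).measure_lt_top⟩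
  have hgw : ∀ x ∈ S, g =ᶠ[𝓝 x] w := fun x hx => hg.eventuallyEq_of_mem (hS.mem_nhds hx)
  have hbound : ∀ᵐ x ∂(volume.restrict S), ‖fderiv ℝ g x e‖ ≤ C * ‖e‖ := by
    have := ae_restrict_of_ae_restrict_of_subset hSM (ae_norm_fderiv_apply_le hw e)
    filter_upwards [this, ae_restrict_mem hS.measurableSet] with x hx hxS
    rwa [(hgw x hxS).fderiv_eq]
  have key := hasDerivAt_integral_comp_add_smul (μ := volume.restrict S) hφ (F.mulVec e)
    (measurable_fderiv_apply_const ℝ g e) hbound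
  refine key.congr_of_eventuallyEq (Eventually.of_forall fun t => ?_)
  refine setIntegral_congr_ae hS.measurableSet ?_
  filter_upwards [ae_differentiableAt_of_lipschitzOnWith_convex (convex_domain M) hw] with x hx hxS
  have hd : DifferentiableAt ℝ g x :=
    (hx (hSM hxS)).2.congr_of_eventuallyEq (hgw x hxS)
  let A : Pt →L[ℝ] Pt := LinearMap.toContinuousLinearMap F.mulVecLin
  have h1 : HasFDerivAt (fun x => F.mulVec x + t • g x) (A + t • fderiv ℝ g x) x :=
    A.hasFDerivAt.add (hd.hasFDerivAt.const_smul t)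
  have h2 := (hy t).eventuallyEq_of_mem (hS.mem_nhds hxS)
  rw [h2.fderiv_eq, h1.fderiv]
  rfl

/-! ### Tiling by the bond volumes of a residue class modulo `η` -/

theorem volume_bondVolume {N : ℕ} (hN : 0 < N) (η l : LPt) :
    volume.real (bondVolume N η l) = spacing N ^ 3 * |((η 0 * η 1 * η 2 : ℤ) : ℝ)| := by
  have hε := spacing_pos hN
  rw [bondVolume_eq_pi, measureReal_def, Real.volume_pi_Ioo_toReal fun i => min_le_max,
    Fin.prod_univ_three]
  simp only [max_sub_min_eq_abs, latticePt_add, add_sub_cancel_left, abs_mul, abs_of_pos hε]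
  push_cast
  rw [abs_mul, abs_mul]
  ring

theorem ae_mem_bondVolume {N : ℕ} (hN : 0 < N) {η : LPt} (hη : ∀ i, η i ≠ 0) (r : LPt) :
    ∀ᵐ x : Pt, x ∈ bondVolume N η (cellIndex N η r x) := by
  have hε := (spacing_pos hN)
  have h1 : ∀ᵐ x : Pt, ∀ (i : Fin 3) (z : ℤ), x i ≠ spacing N * (r i + η i * z) := by
    rw [ae_all_iff]
    intro i
    rw [ae_all_iff]
    intro z
    have := Measure.pi_hyperplane (fun _ : Fin 3 => (volume : Measure ℝ)) i
      (spacing N * (r i + η i * z))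
    rw [← volume_pi] at this
    exact measure_eq_zero_iff_ae_notMem.1 this
  filter_upwards [h1] with x hx
  rw [mem_bondVolume_iff hN hη]
  intro i
  have h2 := (mem_closure_bondVolume_iff hN hη).1 (mem_closure_cellIndex hN hη r x) i
  refine ⟨lt_of_le_of_ne h2.1 ?_, ?_⟩
  · intro h3
    unfold cellIndex at h3
    rw [relCoord_add_mul hη] at h3
    apply hx i ⌊relCoord N η r x i⌋
    rw [eq_of_relCoord hN hη r x i]
    congr 3
    linarith
  · unfold cellIndex
    rw [relCoord_add_mul hη]
    linarith [Int.lt_floor_add_one (relCoord N η r x i)]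

theorem disjoint_bondVolume {N : ℕ} (hN : 0 < N) {η : LPt} (hη : ∀ i, η i ≠ 0) {l m m' : LPt}
    (hne : m ≠ m') :
    Disjoint (bondVolume N η (l + η * m)) (bondVolume N η (l + η * m')) := by
  rw [Set.disjoint_left]
  intro x hx hx'
  rw [mem_bondVolume_iff hN hη] at hx hx'
  apply hne
  ext i
  have h1 := hx i
  have h2 := hx' i
  rw [relCoord_add_mul hη] at h1 h2
  have h3 : (m i : ℝ) < m' i + 1 := by linarith
  have h4 : (m' i : ℝ) < m i + 1 := by linarith
  have h3' : m i < m' i + 1 := by exact_mod_cast h3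
  have h4' : m' i < m i + 1 := by exact_mod_cast h4
  omega

/-- The representative of `l` modulo `η`. -/
def residue (η l : LPt) : LPt := fun i => l i % η i

theorem residue_add_mul_div (η l : LPt) : residue η l + η * (fun i => l i / η i) = l := by
  ext i
  exact Int.emod_add_mul_ediv (l i) (η i)

/-- A set of representatives of the lattice points modulo `η`. -/
def residues (η : LPt) : Finset LPt := Fintype.piFinset fun i => Finset.Ico 0 |η i|

theorem residue_mem_residues {η : LPt} (hη : ∀ i, η i ≠ 0) (l : LPt) :
    residue η l ∈ residues η := by
  rw [residues, Fintype.mem_piFinset]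
  intro i
  exact Finset.mem_Ico.2 ⟨Int.emod_nonneg _ (hη i), Int.emod_lt_abs _ (hη i)⟩

theorem residue_add_mul {η r : LPt} (hr : r ∈ residues η) (m : LPt) :
    residue η (r + η * m) = r := by
  rw [residues, Fintype.mem_piFinset] at hr
  ext i
  have h := Finset.mem_Ico.1 (hr i)
  simp only [residue, Pi.add_apply, Pi.mul_apply, Int.add_mul_emod_self_left]
  rw [← Int.emod_abs]
  exact Int.emod_eq_of_lt h.1 h.2

theorem card_residues (η : LPt) : ((residues η).card : ℝ) = |((η 0 * η 1 * η 2 : ℤ) : ℝ)| := by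
  rw [residues, Fintype.card_piFinset, Fin.prod_univ_three]
  have h : ∀ i, (((Finset.Ico 0 |η i|).card : ℕ) : ℝ) = |(η i : ℝ)| := fun i => by
    rw [Int.card_Ico, sub_zero, ← Int.cast_natCast, Int.toNat_of_nonneg (abs_nonneg _), Int.cast_abs]
  push_cast
  rw [h, h, h, abs_mul, abs_mul]

/-! ### The strain balance from vanishing mean gradients -/

namespace IsCoupledProblem

variable {N k : ℕ} {M : Fin 3 → ℕ} {R : Finset LPt} {Ωa Ωs : Set Pt}
  {dec : LPt → LPt → Finset (Finset LPt)} {𝒯c : Finset (Finset LPt)} {v : Pt → Pt}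

theorem a_subset_domain (h : IsCoupledProblem N k M R Ωa Ωs dec 𝒯c v) : Ωa ⊆ domain M :=
  subset_closure.trans (h.splitting.interior_domain.trans interior_subset)

theorem s_subset_domain (h : IsCoupledProblem N k M R Ωa Ωs dec 𝒯c v) : Ωs ⊆ domain M := by
  rw [h.splitting.cover]
  exact subset_closure.trans subset_union_right

/-- The closure of `Ωs` is a finite union of convex hulls, whose frontiers are null. Off these
frontiers, the identity of each region with the interior of its closure puts the point in one of
them. -/
theorem ae_mem_or_mem (h : IsCoupledProblem N k M R Ωa Ωs dec 𝒯c v) :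
    ∀ᵐ x : Pt, x ∈ domain M → x ∈ Ωa ∪ Ωs := by
  have h1 : ∀ᵐ x : Pt, ∀ T ∈ 𝒯c, x ∉ frontier (hull N T) := by
    rw [Finset.eventually_all]
    exact fun T _ => measure_eq_zero_iff_ae_notMem.1 ((convex_hull N T).addHaar_frontier volume)
  filter_upwards [h1] with x hx hxM
  by_contra hn
  rw [mem_union, not_or] at hn
  have hxs : x ∈ closure Ωs := by
    by_contra hxs
    have hxa : x ∈ closure Ωa := by
      rw [h.splitting.cover] at hxM
      exact hxM.resolve_right hxs
    apply hn.1
    rw [← h.splitting.region_a.interior_closure, mem_interior_iff_mem_nhds]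
    filter_upwards [mem_interior_iff_mem_nhds.1 (h.splitting.interior_domain hxa),
      isClosed_closure.isOpen_compl.mem_nhds hxs] with y hy hys
    rw [h.splitting.cover] at hy
    exact hy.resolve_right hys
  obtain ⟨T, hT, hxT⟩ := h.exists_mesh_mem_hull hxs
  refine hx T hT ⟨subset_closure hxT, fun hint => hn.2 ?_⟩
  rw [← h.splitting.region_s.interior_closure]
  refine interior_mono ?_ hint
  rw [← h.mesh.decomposition.cover]
  exact fun y hy => mem_biUnion hT hy

/-- A point and its translate can both lie in `Ω` only on opposite faces, away from the closed
atomistic region, where the field is the periodic `v`. -/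
theorem gluedField_periodic (h : IsCoupledProblem N k M R Ωa Ωs dec 𝒯c v) (hM : ∀ i, 0 < M i)
    (η r : LPt) (i : Fin 3) (x : Pt) (hx : x ∈ domain M)
    (hx' : x + Pi.single i (2 * (M i : ℝ) - 1) ∈ domain M) :
    gluedField N M Ωa Ωs dec v η r (x + Pi.single i (2 * (M i : ℝ) - 1)) =
      gluedField N M Ωa Ωs dec v η r x := by
  have hMi : (1 : ℝ) ≤ M i := by exact_mod_cast hM i
  have hint : ∀ z ∈ closure Ωa, -(M i : ℝ) + 1 < z i ∧ z i < M i := by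
    intro z hz
    have h1 := h.splitting.interior_domain hz
    have h2 : domain M = Set.pi univ fun i => Icc (-(M i : ℝ) + 1) (M i) := by
      ext x; simp only [domain, mem_ofPred_eq, mem_univ_pi, mem_Icc]
    rw [h2, interior_pi_set finite_univ] at h1
    simpa only [interior_Icc, mem_Ioo] using h1 i (mem_univ _)
  have h1 := hx i
  have h2 := hx' i
  rw [Pi.add_apply, Pi.single_eq_same] at h2
  have hxa : x ∉ closure Ωa := fun ha => by linarith [(hint x ha).1]
  have hxa' : x + Pi.single i (2 * (M i : ℝ) - 1) ∉ closure Ωa := fun ha => by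
    have := (hint _ ha).2
    rw [Pi.add_apply, Pi.single_eq_same] at this
    linarith
  rw [gluedField, gluedField, if_neg hxa, if_neg hxa', h.mem.periodic i x hx hx']

theorem gluedField_eqOn_s (h : IsCoupledProblem N k M R Ωa Ωs dec 𝒯c v) {η : LPt}
    (hη : η ∈ R) (r : LPt) : EqOn v (gluedField N M Ωa Ωs dec v η r) Ωs :=
  fun _ hx => (h.gluedField_eq_of_mem_closure_s hη r (subset_closure hx)).symm

theorem gluedField_eqOn_bondVolume (h : IsCoupledProblem N k M R Ωa Ωs dec 𝒯c v) {η : LPt}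
    (hη : η ∈ R) (l : LPt) : EqOn (localField N M Ωa Ωs dec v η l)
      (gluedField N M Ωa Ωs dec v η (residue η l)) (bondVolume N η l ∩ Ωa) := by
  intro x hx
  have hl := residue_add_mul_div η l
  have := h.gluedField_eq_localField hη (residue η l) (fun i => l i / η i)
    (subset_closure hx.2) (by rw [hl]; exact subset_closure hx.1)
  rw [hl] at this
  exact this.symm

/-- This is the vanishing mean gradient of the glued field, split over `Ωs` and the atomistic parts
of the boxes of one class. On each of these open sets the field coincides with `v` or with a local
field, so the derivatives agree. -/
theorem integral_residue_class (h : IsCoupledProblem N k M R Ωa Ωs dec 𝒯c v)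
    (hM : ∀ i, 0 < M i) {η : LPt} (hη : η ∈ R) {r : LPt} (hr : r ∈ residues η) (e : Pt) :
    (∫ x in Ωs, fderiv ℝ v x e) + ∑ l ∈ latticePeriod N M with residue η l = r,
      ∫ x in bondVolume N η l ∩ Ωa, fderiv ℝ (localField N M Ωa Ωs dec v η l) x e = 0 := by
  have hb := h.bond η hη
  obtain ⟨C, hC⟩ := h.exists_lipschitzOnWith_gluedField hη r
  set w := gluedField N M Ωa Ωs dec v η r with hw
  have hint := integrableOn_fderiv_apply hC e
  have hzero := integral_fderiv_apply_eq_zero hM hC (h.gluedField_periodic hM η r) e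
  have hdom : (Ωa ∪ Ωs : Set Pt) =ᵐ[volume] domain M := by
    filter_upwards [h.ae_mem_or_mem] with x hx
    exact propext ⟨fun hu => hu.elim (fun ha => h.a_subset_domain ha) fun hs => h.s_subset_domain hs,
      hx⟩
  rw [← setIntegral_congr_set hdom, setIntegral_union h.splitting.disjoint h.isOpen_s.measurableSet
    (hint.mono_set h.a_subset_domain) (hint.mono_set h.s_subset_domain)] at hzero
  have hs : ∫ x in Ωs, fderiv ℝ v x e = ∫ x in Ωs, fderiv ℝ w x e := by
    refine setIntegral_congr_fun h.isOpen_s.measurableSet fun x hx => ?_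
    have := (h.gluedField_eqOn_s hη r).eventuallyEq_of_mem (h.isOpen_s.mem_nhds hx)
    simp only [this.fderiv_eq, hw]
  set I := {l ∈ latticePeriod N M | residue η l = r} with hI
  have hopen : ∀ l, IsOpen (bondVolume N η l ∩ Ωa) := fun l =>
    (isOpen_bondVolume N η l).inter h.isOpen_a
  have ha : ∀ l ∈ I, ∫ x in bondVolume N η l ∩ Ωa,
      fderiv ℝ (localField N M Ωa Ωs dec v η l) x e =
        ∫ x in bondVolume N η l ∩ Ωa, fderiv ℝ w x e := by
    intro l hl
    refine setIntegral_congr_fun (hopen l).measurableSet fun x hx => ?_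
    have := (h.gluedField_eqOn_bondVolume hη l).eventuallyEq_of_mem ((hopen l).mem_nhds hx)
    rw [(Finset.mem_filter.1 hl).2] at this
    simp only [this.fderiv_eq, hw]
  have hcell : (⋃ l ∈ I, bondVolume N η l ∩ Ωa) =ᵐ[volume] Ωa := by
    filter_upwards [ae_mem_bondVolume h.pos hb r] with x hx
    refine propext ⟨fun hu => ?_, fun hxa => ?_⟩
    · obtain ⟨l, -, hl⟩ := mem_iUnion₂.1 hu
      exact hl.2
    · refine mem_iUnion₂.2 ⟨cellIndex N η r x, Finset.mem_filter.2 ⟨?_, residue_add_mul hr _⟩,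
        hx, hxa⟩
      exact mem_latticePeriod h.pos (interior_subset (h.closure_bondVolume_subset hη
        (subset_closure hx) (subset_closure hxa) (latticePt_mem_closure_bondVolume h.pos hb _)))
  have hsum : ∫ x in Ωa, fderiv ℝ w x e =
      ∑ l ∈ I, ∫ x in bondVolume N η l ∩ Ωa, fderiv ℝ w x e := by
    rw [← setIntegral_congr_set hcell]
    refine integral_biUnion_finset I (fun l _ => (hopen l).measurableSet) ?_ fun l _ =>
      hint.mono_set (inter_subset_right.trans h.a_subset_domain)
    intro l hl l' hl' hne
    have e1 := residue_add_mul_div η l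
    have e2 := residue_add_mul_div η l'
    rw [(Finset.mem_filter.1 (Finset.mem_coe.1 hl)).2] at e1
    rw [(Finset.mem_filter.1 (Finset.mem_coe.1 hl')).2] at e2
    refine Disjoint.mono inter_subset_left inter_subset_left ?_
    rw [← e1, ← e2]
    refine disjoint_bondVolume h.pos hb fun heq => hne ?_
    rw [← e1, ← e2, heq]
  rw [Finset.sum_congr rfl ha, ← hsum, hs, add_comm]
  exact hzero

/-- The interpolant is differentiable almost everywhere, and there its derivative along `η` is the
line derivative along the main diagonal, which is the same constant throughout the box. -/
theorem integral_localField_of_inAtomistic (h : IsCoupledProblem N k M R Ωa Ωs dec 𝒯c v)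
    {η : LPt} (hη : η ∈ R) {l : LPt} (ha : InAtomistic N Ωa η l) :
    ∫ x in bondVolume N η l ∩ Ωa, fderiv ℝ (localField N M Ωa Ωs dec v η l) x (toVec η) =
      (spacing N ^ 3 * |((η 0 * η 1 * η 2 : ℤ) : ℝ)|) • diffQuot N η v l := by
  have hb := h.bond η hη
  obtain ⟨C, hC⟩ := h.exists_lipschitzOnWith_gluedField hη (residue η l)
  have hsub : bondVolume N η l ∩ Ωa = bondVolume N η l :=
    inter_eq_left.2 (subset_closure.trans ha)
  have heq := h.gluedField_eqOn_bondVolume hη l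
  rw [hsub] at heq ⊢
  have hopen := isOpen_bondVolume N η l
  rw [← volume_bondVolume h.pos η l, ← setIntegral_const]
  refine setIntegral_congr_ae hopen.measurableSet ?_
  filter_upwards [ae_differentiableAt_of_lipschitzOnWith_convex (convex_domain M) hC] with x hx hxB
  have hd : DifferentiableAt ℝ (localField N M Ωa Ωs dec v η l) x :=
    (hx (h.a_subset_domain (ha (subset_closure hxB)))).2.congr_of_eventuallyEq
      (heq.eventuallyEq_of_mem (hopen.mem_nhds hxB))
  have hloc : localField N M Ωa Ωs dec v η l = interpolant N (typeA l η) v := by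
    ext1 z
    rw [localField, if_neg (fun hn => hn.1 ha), localMesh, if_pos ha]
  rw [hloc] at hd ⊢
  have hline : HasLineDerivAt ℝ (interpolant N (typeA l η) v) (diffQuot N η v l) x (toVec η) := by
    have h1 : HasDerivAt (fun s : ℝ => interpolant N (typeA l η) v x + s • diffQuot N η v l)
        (diffQuot N η v l) 0 := by
      simpa using ((hasDerivAt_id (0 : ℝ)).smul_const (diffQuot N η v l)).const_add
        (interpolant N (typeA l η) v x)
    exact h1.congr_of_eventuallyEq (interpolant_typeA_add_smul h.pos hb hxB v)
  exact (hd.hasFDerivAt.hasLineDerivAt (toVec η)).unique hline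

open Classical in
/-- The balance of the averaged strains along a bond direction. -/
theorem balance (h : IsCoupledProblem N k M R Ωa Ωs dec 𝒯c v) (hM : ∀ i, 0 < M i)
    {η : LPt} (hη : η ∈ R) :
    spacing N ^ 3 • ∑ l ∈ latticePeriod N M with InAtomistic N Ωa η l, diffQuot N η v l +
      (∫ x in Ωs, fderiv ℝ v x (toVec η)) +
      ∑ l ∈ latticePeriod N M with AtInterface N M Ωa Ωs η l,
        (1 / |((η 0 * η 1 * η 2 : ℤ) : ℝ)|) • ∫ x in bondVolume N η l ∩ Ωa,
          fderiv ℝ (localField N M Ωa Ωs dec v η l) x (toVec η) = 0 := by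
  have hb := h.bond η hη
  set J := ∫ x in Ωs, fderiv ℝ v x (toVec η)
  set q : ℝ := |((η 0 * η 1 * η 2 : ℤ) : ℝ)| with hq
  have hq0 : q ≠ 0 := by
    rw [hq, abs_ne_zero, Int.cast_ne_zero]
    exact mul_ne_zero (mul_ne_zero (hb 0) (hb 1)) (hb 2)
  set g : LPt → Pt := fun l => ∫ x in bondVolume N η l ∩ Ωa,
    fderiv ℝ (localField N M Ωa Ωs dec v η l) x (toVec η) with hg
  -- Class (b) bond volumes contribute nothing, since they do not meet `Ωa`.
  have hclass : ∀ l, g l = (if InAtomistic N Ωa η l then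
      (spacing N ^ 3 * q) • diffQuot N η v l else 0) +
      if AtInterface N M Ωa Ωs η l then g l else 0 := by
    intro l
    by_cases ha : InAtomistic N Ωa η l
    · rw [if_pos ha, if_neg fun hn => hn.1 ha, add_zero]
      exact h.integral_localField_of_inAtomistic hη ha
    · rw [if_neg ha, zero_add]
      split_ifs with hi
      · rfl
      · have hc : InContinuum N M Ωs η l := by
          by_contra hc
          exact hi ⟨ha, hc⟩
        have hempty : bondVolume N η l ∩ Ωa = ∅ := by
          rw [Set.eq_empty_iff_forall_notMem]
          rintro x ⟨hx, hxa⟩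
          exact h.notMem_closure_s hxa (h.mem_closure_s_of_inContinuum hη (subset_closure hx)
            (subset_closure hxa) hc).2
        simp only [hg, hempty, Measure.restrict_empty, integral_zero_measure]
  -- There are `q` residues, so the continuum integral is counted `q` times, whereas each bond
  -- volume belongs to exactly one class.
  have htotal : q • J + ∑ l ∈ latticePeriod N M, g l = 0 := by
    have h1 : ∑ r ∈ residues η, (J + ∑ l ∈ latticePeriod N M with residue η l = r, g l) = 0 :=
      Finset.sum_eq_zero fun r hr => h.integral_residue_class hM hη hr (toVec η)
    rwa [Finset.sum_add_distrib, Finset.sum_const, ← Nat.cast_smul_eq_nsmul ℝ, card_residues,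
      Finset.sum_fiberwise_of_maps_to fun l _ => residue_mem_residues hb l] at h1
  rw [Finset.sum_congr rfl fun l _ => hclass l, Finset.sum_add_distrib, ← Finset.sum_filter,
    ← Finset.sum_filter, ← Finset.smul_sum] at htotal
  have h2 := congrArg (fun z => q⁻¹ • z) htotal
  simp only [smul_add, smul_zero, smul_smul] at h2
  rw [inv_mul_cancel₀ hq0, one_smul, show q⁻¹ * (spacing N ^ 3 * q) = spacing N ^ 3 by
    field_simp] at h2
  rw [← Finset.smul_sum, one_div, ← h2]
  abel

/-! ### First variations of the three energy contributions -/

open Classical in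
theorem hasDerivAt_energyAtomistic (N : ℕ) (hN : 0 < N) (M : Fin 3 → ℕ) (Ωa : Set Pt)
    {φ : Pt → ℝ} (hφ : ContDiff ℝ 1 φ) (η : LPt) (F : Matrix (Fin 3) (Fin 3) ℝ) (v : Pt → Pt) :
    HasDerivAt (fun t : ℝ => energyAtomistic N M Ωa φ η fun x => F.mulVec x + t • v x)
      (spacing N ^ 3 * ∑ l ∈ latticePeriod N M with InAtomistic N Ωa η l,
        fderiv ℝ φ (F.mulVec (toVec η)) (diffQuot N η v l)) 0 := by
  have hε := (spacing_pos hN).ne'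
  unfold energyAtomistic
  refine HasDerivAt.const_mul _ ?_
  refine HasDerivAt.fun_sum fun l _ => ?_
  have h1 : ∀ t : ℝ, diffQuot N η (fun x => F.mulVec x + t • v x) l =
      F.mulVec (toVec η) + t • diffQuot N η v l := by
    intro t
    have h2 : toVec η = (spacing N)⁻¹ • (latticePt N (l + η) - latticePt N l) := by
      ext i
      rw [Pi.smul_apply, Pi.sub_apply, latticePt_add, add_sub_cancel_left, smul_eq_mul,
        inv_mul_cancel_left₀ hε]
      rfl
    rw [h2, Matrix.mulVec_smul, Matrix.mulVec_sub]
    simp only [diffQuot]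
    module
  simp only [h1]
  have h3 : HasDerivAt (fun t : ℝ => F.mulVec (toVec η) + t • diffQuot N η v l)
      (diffQuot N η v l) 0 := by
    simpa using ((hasDerivAt_id (0 : ℝ)).smul_const (diffQuot N η v l)).const_add
      (F.mulVec (toVec η))
  have h4 := (hφ.differentiable one_ne_zero (F.mulVec (toVec η))).hasFDerivAt
  have h5 : F.mulVec (toVec η) = F.mulVec (toVec η) + (0 : ℝ) • diffQuot N η v l := by simp
  rw [h5] at h4
  have h6 := h4.comp_hasDerivAt (0 : ℝ) h3
  rwa [← h5] at h6

theorem hasDerivAt_energyContinuum (h : IsCoupledProblem N k M R Ωa Ωs dec 𝒯c v) {η : LPt}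
    (hη : η ∈ R) {φ : Pt → ℝ} (hφ : ContDiff ℝ 1 φ) (F : Matrix (Fin 3) (Fin 3) ℝ) :
    HasDerivAt (fun t : ℝ => energyContinuum Ωs φ η fun x => F.mulVec x + t • v x)
      (fderiv ℝ φ (F.mulVec (toVec η)) (∫ x in Ωs, fderiv ℝ v x (toVec η))) 0 := by
  -- Any residue would do: every glued field is a Lipschitz function on `Ω` that agrees with `v` on
  -- `Ωs`.
  obtain ⟨C, hC⟩ := h.exists_lipschitzOnWith_gluedField hη 0
  exact hasDerivAt_energy hφ h.isOpen_s h.s_subset_domain hC (h.gluedField_eqOn_s hη 0) F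
    (fun t => fun x _ => rfl) (toVec η)

open Classical in
theorem hasDerivAt_energyInterface (h : IsCoupledProblem N k M R Ωa Ωs dec 𝒯c v) {η : LPt}
    (hη : η ∈ R) {φ : Pt → ℝ} (hφ : ContDiff ℝ 1 φ) (F : Matrix (Fin 3) (Fin 3) ℝ) :
    HasDerivAt (fun t : ℝ => energyInterface N M Ωa Ωs dec φ η fun x => F.mulVec x + t • v x)
      (∑ l ∈ latticePeriod N M with AtInterface N M Ωa Ωs η l,
        (1 / |((η 0 * η 1 * η 2 : ℤ) : ℝ)|) * fderiv ℝ φ (F.mulVec (toVec η))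
          (∫ x in bondVolume N η l ∩ Ωa,
            fderiv ℝ (localField N M Ωa Ωs dec v η l) x (toVec η))) 0 := by
  unfold energyInterface
  refine HasDerivAt.fun_sum fun l hl => HasDerivAt.const_mul _ ?_
  obtain ⟨-, hl⟩ := Finset.mem_filter.1 hl
  obtain ⟨C, hC⟩ := h.exists_lipschitzOnWith_gluedField hη (residue η l)
  simp only [setIntegral_indicator h.isOpen_a.measurableSet]
  refine hasDerivAt_energy hφ ((isOpen_bondVolume N η l).inter h.isOpen_a)
    (inter_subset_right.trans h.a_subset_domain) hC (h.gluedField_eqOn_bondVolume hη l) F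
    (fun t x hx => ?_) (toVec η)
  have hn : ¬ (¬ InAtomistic N Ωa η l ∧ InContinuum N M Ωs η l) := fun hn => hl.2 hn.2
  have hcov := h.exists_localMesh hη hn (subset_closure hx.1)
  rw [localMesh, if_neg hl.1] at hcov
  have hloc : localField N M Ωa Ωs dec v η l x = interpolant N (dec η l) v x := by
    rw [localField, if_neg hn, localMesh, if_neg hl.1]
  change _ = F.mulVec x + t • localField N M Ωa Ωs dec v η l x
  rw [interpolant_mulVec_add h.pos hcov, hloc]

end IsCoupledProblem

end ACCoupling

end

theorem proposition6p1
    (N k : ℕ) (hN : 0 < N) (M : Fin 3 → ℕ) (hM : ∀ i, 0 < M i)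
    (R : Finset ACCoupling.LPt) (hR : ∀ η ∈ R, η 0 * η 1 * η 2 ≠ 0)
    (φ : ACCoupling.LPt → ACCoupling.Pt → ℝ) (hφ : ∀ η ∈ R, ContDiff ℝ 1 (φ η))
    (Ωa Ωs : Set ACCoupling.Pt) (hΩ : ACCoupling.IsSplitting N M R Ωa Ωs)
    (dec : ACCoupling.LPt → ACCoupling.LPt → Finset (Finset ACCoupling.LPt))
    (hdec : ACCoupling.IsInterfaceDecomposition N M R Ωa Ωs dec)
    (𝒯c : Finset (Finset ACCoupling.LPt)) (h𝒯c : ACCoupling.IsContinuumMesh N Ωa Ωs 𝒯c)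
    (F : Matrix (Fin 3) (Fin 3) ℝ) (hF : 0 < F.det)
    (v : ACCoupling.Pt → ACCoupling.Pt)
    (hv : ACCoupling.MemCoupledSpace N k M Ωa Ωs 𝒯c v) :
    HasDerivAt
      (fun t : ℝ => ACCoupling.coupledEnergy N M R φ Ωa Ωs dec (fun x => F.mulVec x + t • v x))
      0 0 := by
  classical
  have h : ACCoupling.IsCoupledProblem N k M R Ωa Ωs dec 𝒯c v :=
    { pos := hN
      bond := fun η hη i => by
        have := hR η hη
        intro h0
        apply this
        fin_cases i <;> simp_all
      splitting := hΩ
      interfaceDec := hdec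
      mesh := h𝒯c
      mem := hv }
  unfold ACCoupling.coupledEnergy
  refine (HasDerivAt.fun_sum (A' := fun _ => (0 : ℝ)) fun η hη => ?_).congr_deriv
    Finset.sum_const_zero
  have hd := ((ACCoupling.IsCoupledProblem.hasDerivAt_energyAtomistic N hN M Ωa (hφ η hη) η F
    v).add (h.hasDerivAt_energyContinuum hη (hφ η hη) F)).add
    (h.hasDerivAt_energyInterface hη (hφ η hη) F)
  -- All three first variations carry the same linear functional, so applying it to the strain
  -- balance gives their sum.
  have hbal := congrArg (fderiv ℝ (φ η) (F.mulVec (ACCoupling.toVec η))) (h.balance hM hη)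
  simp only [map_add, map_smul, map_sum, map_zero, smul_eq_mul] at hbal
  rw [hbal] at hd
  exact hd
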